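/- All graphs are finite, simple and undirected, and $G[S]$ denotes the subgraph of $G$ induced by a vertex set $S$. A vertex set $S$ is a \emph{2-club} in $G$ if $G[S]$ has diameter at most two. It is a \emph{$t$-robust 2-club} if any two distinct vertices of $S$ are connected in $G[S]$ by $t$ internally vertex-disjoint paths of length at most two, and a \emph{$t$-hereditary 2-club} if $G[S\setminus U]$ is a 2-club for all $U\subseteq S$ with $|U|\le t$. The problem \textsc{$t$-Robust 2-Club} (\textsc{$t$-Hereditary 2-Club}) asks, given a graph $G$ and nonnegative integers $t$ and $k$, whether $G$ contains a $t$-robust (respectively $t$-hereditary) 2-club of size at least $k$; let $n$ be the number of vertices of $G$ and $\ell := n-k$. The Strong Exponential Time Hypothesis (SETH) states that for no $\varepsilon>0$ can the satisfiability of Boolean formulas $F$ in conjunctive normal form with $N$ variables be decided in time $(2-\varepsilon)^{N}\cdot |F|^{O(1)}$, where $|F|$ is the size of $F$. Running times, here and below, are numbers of steps of deterministic multi-tape Turing machines. \textbf{Theorem.} If SETH holds, then for every $\varepsilon>0$: (i) for every fixed $t\ge 1$, \textsc{$t$-Robust 2-Club} does not admit a $(2-\varepsilon)^{\ell}\cdot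 n^{O(1)}$-time algorithm, and (ii) for every fixed $t\ge 0$, \textsc{$t$-Hereditary 2-Club} does not admit a $(2-\varepsilon)^{\ell}\cdot n^{O(1)}$-time algorithm. Both statements hold even if the algorithm is only required to work for connected graphs and $k\le n$. -/

import Mathlib

/-- A set `S` of vertices is a 2-club of `G` if the induced subgraph `G[S]` has diameter at most
two (the extended diameter is infinite when `G[S]` is disconnected). -/
def IsTwoClub {V : Type} (G : SimpleGraph V) (S : Set V) : Prop :=
  (G.induce S).ediam ≤ 2

/-- `S` is a `t`-robust 2-club of `G`: any two distinct vertices of `S` are connected in `G[S]` by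
`t` (distinct) internally vertex-disjoint paths of length at most two. -/
def IsRobustTwoClub {V : Type} (t : ℕ) (G : SimpleGraph V) (S : Set V) : Prop :=
  ∀ u v : S, u ≠ v → ∃ P : Fin t → (G.induce S).Path u v,
    Function.Injective P ∧
    (∀ i, (P i : (G.induce S).Walk u v).length ≤ 2) ∧
    ∀ i j, i ≠ j → ∀ w, w ∈ (P i : (G.induce S).Walk u v).support →
      w ∈ (P j : (G.induce S).Walk u v).support → w = u ∨ w = v

/-- `S` is a `t`-hereditary 2-club of `G`: deleting at most `t` vertices of `S` leaves a 2-club. -/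
def IsHereditaryTwoClub {V : Type} (t : ℕ) (G : SimpleGraph V) (S : Set V) : Prop :=
  ∀ U : Finset V, (U : Set V) ⊆ S → U.card ≤ t → IsTwoClub G (S \ U)

/-- An instance of the (robust or hereditary) 2-club problem: a graph on `n` vertices and
nonnegative integers `t` and `k`. -/
structure ClubInstance where
  n : ℕ
  graph : SimpleGraph (Fin n)
  t : ℕ
  k : ℕ

/-- The question of `t`-Robust 2-Club. -/
def ClubInstance.HasRobustTwoClub (x : ClubInstance) : Prop :=
  ∃ S : Finset (Fin x.n), x.k ≤ S.card ∧ IsRobustTwoClub x.t x.graph (S : Set (Fin x.n))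

/-- The question of `t`-Hereditary 2-Club. -/
def ClubInstance.HasHereditaryTwoClub (x : ClubInstance) : Prop :=
  ∃ S : Finset (Fin x.n), x.k ≤ S.card ∧ IsHereditaryTwoClub x.t x.graph (S : Set (Fin x.n))

/-- A formula in conjunctive normal form over `numVars` variables, as a list of clauses; a clause
is a list of literals, and the literal `(i, b)` is satisfied when variable `i` has value `b`. -/
structure CNFFormula where
  numVars : ℕ
  clauses : List (List (Fin numVars × Bool))

def CNFFormula.Satisfiable (F : CNFFormula) : Prop :=
  ∃ a : Fin F.numVars → Bool, ∀ c ∈ F.clauses, ∃ l ∈ c, a l.1 = l.2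

/-! Inputs are strings over the three letters `some false`, `some true` and the separator `none`. -/

/-- The number `m` in unary, followed by a separator. -/
def encodeUnary (m : ℕ) : List (Option Bool) :=
  List.replicate m (some true) ++ [none]

/-- A literal is its sign followed by the index of its variable; a clause is the sequence of its
literals, closed by a separator; a formula is its number of variables and the sequence of its
clauses. -/
def CNFFormula.encode (F : CNFFormula) : List (Option Bool) :=
  encodeUnary F.numVars ++
    F.clauses.flatMap fun c => (c.flatMap fun l => some l.2 :: encodeUnary l.1) ++ [none]

open Classical in
/-- The numbers `t`, `k`, `n`, followed by the adjacency matrix, row by row. -/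
noncomputable def ClubInstance.encode (x : ClubInstance) : List (Option Bool) :=
  encodeUnary x.t ++ encodeUnary x.k ++ encodeUnary x.n ++
    (List.finRange x.n).flatMap fun i =>
      (List.finRange x.n).map fun j => some (decide (x.graph.Adj i j))

open Classical in
/-- Some (multi-tape) Turing machine, given the encoding of any `x : ι` in the range `valid`,
halts after at most `bound x` steps with the correct answer to the question `yes x`. -/
def SolvableInTime {ι : Type} (enc : ι → List (Option Bool)) (valid yes : ι → Prop)
    (bound : ι → ℝ) : Prop :=
  ∃ M : Turing.TM2ComputableAux (Option Bool) Bool, ∀ x, valid x → ∃ T : ℕ, (T : ℝ) ≤ bound x ∧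
    Nonempty (Turing.TM2OutputsInTime M.tm ((enc x).map M.inputAlphabet.symm)
      (some ([decide (yes x)].map M.outputAlphabet.symm)) T)

/-- The Strong Exponential Time Hypothesis: for no `ε > 0` can satisfiability of CNF formulas `F`
with `N` variables be decided in time `(2 - ε) ^ N * |F| ^ O(1)`. -/
def StrongExponentialTimeHypothesis : Prop :=
  ∀ ε : ℝ, 0 < ε → ¬ ∃ C c : ℕ,
    SolvableInTime CNFFormula.encode (fun _ => True) CNFFormula.Satisfiable
      fun F => C * (2 - ε) ^ F.numVars * (F.encode.length : ℝ) ^ c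

/-- For the fixed value `t`, the problem with question `yes` admits an algorithm with running time
`(2 - ε) ^ (n - k) * n ^ O(1)`, where `n` is the number of vertices. The algorithm is only required
to work on instances with this value of `t` (so it may be specific to `t`, and so may the
constants), with a connected graph and with `k ≤ n`. -/
def AdmitsDualParameterAlgorithm (yes : ClubInstance → Prop) (t : ℕ) (ε : ℝ) : Prop :=
  ∃ C c : ℕ,
    SolvableInTime ClubInstance.encode (fun x => x.t = t ∧ x.graph.Connected ∧ x.k ≤ x.n) yes
      fun x => C * (2 - ε) ^ (x.n - x.k) * (x.n : ℝ) ^ c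

/-!
Satisfiability of formulas with `N` variables reduces to the 2-club problems with `ℓ = N`. The graph
of a formula has a vertex for each literal, two copies of each clause, four hubs and `q` apexes. The
apexes are adjacent to everything, so each of them adds one to the robustness of a club. Apart from
them, the two opposite literals of a variable have no common neighbour and are not adjacent, so a
club omits one literal of each variable. A club of size at least `k = n - N` omits nothing else, and
thus amounts to an assignment. The common neighbours of the two copies of a clause are its literals,
so one of these has to be kept: the assignment satisfies the clause.

A Turing machine writes this instance in polynomial time. Hence an algorithm with running time
`(2 - ε) ^ ℓ * n ^ O(1)` decides satisfiability in time `(2 - ε) ^ N * |F| ^ O(1)`.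
-/

/-! ### Reachability within a given number of steps -/

/-- `b` is reached from `a` in at most `T` steps of the transition function `f`. -/
def ReachesWithin {α : Type*} (f : α → Option α) (T : ℕ) (a b : α) : Prop :=
  Nonempty (StateTransition.EvalsToInTime f a (some b) T)

namespace ReachesWithin

variable {α β : Type*} {f : α → Option α} {g : β → Option β} {a b c : α} {T T' : ℕ}

theorem refl (f : α → Option α) (a : α) : ReachesWithin f 0 a a :=
  ⟨.refl f a⟩

theorem single (h : f a = some b) : ReachesWithin f 1 a b :=
  ⟨⟨⟨1, h⟩, le_rfl⟩⟩

theorem mono (h : ReachesWithin f T a b) (hT : T ≤ T') : ReachesWithin f T' a b :=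
  h.map fun r => ⟨r.toEvalsTo, r.steps_le_m.trans hT⟩

theorem trans (h₁ : ReachesWithin f T a b) (h₂ : ReachesWithin f T' b c) :
    ReachesWithin f (T + T') a c :=
  h₁.elim fun r₁ => h₂.elim fun r₂ => ⟨add_comm T' T ▸ r₁.trans _ _ _ _ _ _ r₂⟩

theorem head (h₁ : f a = some b) (h₂ : ReachesWithin f T b c) : ReachesWithin f (T + 1) a c :=
  ((single h₁).trans h₂).mono (add_comm 1 T).le

theorem map (tr : α → β) (hstep : ∀ a b, f a = some b → g (tr a) = some (tr b))
    (h : ReachesWithin f T a b) : ReachesWithin g T (tr a) (tr b) := by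
  obtain ⟨⟨⟨n, hn⟩, hnT⟩⟩ := h
  refine ⟨⟨⟨n, ?_⟩, hnT⟩⟩
  clear hnT
  induction n generalizing b with
  | zero => rw [Option.some.inj hn]; rfl
  | succ n ih =>
    rw [Function.iterate_succ_apply'] at hn ⊢
    obtain ⟨b', hb', hb⟩ := Option.bind_eq_some_iff.1 hn
    rw [ih hb']
    exact hstep b' b hb

end ReachesWithin

/-! ### Sequential composition of Turing machines -/

open Turing

/-- On the input `s`, the machine `M` halts after at most `T` steps with the output `s'`. -/
def OutputsWithin {Γ₀ Γ₁ : Type} (M : TM2ComputableAux Γ₀ Γ₁) (T : ℕ) (s : List Γ₀)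
    (s' : List Γ₁) : Prop :=
  Nonempty (TM2OutputsInTime M.tm (s.map M.inputAlphabet.symm)
    (some (s'.map M.outputAlphabet.symm)) T)

theorem initList_eq_update (M : FinTM2) (s : List (M.Γ M.k₀)) :
    initList M s = ⟨some M.main, M.initialState, Function.update (fun _ => []) M.k₀ s⟩ := by
  refine congrArg (TM2.Cfg.mk _ _) (funext fun k => ?_)
  by_cases h : k = M.k₀
  · subst h; simp
  · simp [h]

theorem haltList_eq_update (M : FinTM2) (s : List (M.Γ M.k₁)) :
    haltList M s = ⟨none, M.initialState, Function.update (fun _ => []) M.k₁ s⟩ := by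
  refine congrArg (TM2.Cfg.mk _ _) (funext fun k => ?_)
  by_cases h : k = M.k₁
  · subst h; simp
  · simp [h]

theorem outputsWithin_iff_reachesWithin {Γ₀ Γ₁ : Type} {M : TM2ComputableAux Γ₀ Γ₁} {T : ℕ}
    {s : List Γ₀} {s' : List Γ₁} :
    OutputsWithin M T s s' ↔ ReachesWithin (TM2.step M.tm.m) T
      ⟨some M.tm.main, M.tm.initialState,
        Function.update (fun _ => []) M.tm.k₀ (s.map M.inputAlphabet.symm)⟩
      ⟨none, M.tm.initialState,
        Function.update (fun _ => []) M.tm.k₁ (s'.map M.outputAlphabet.symm)⟩ := by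
  unfold OutputsWithin ReachesWithin TM2OutputsInTime
  rw [initList_eq_update, Option.map_some, haltList_eq_update]
  rfl

namespace runThen

open TM2.Stmt

variable {Γ₀ Γ₁ Γ₂ : Type} (P : TM2ComputableAux Γ₀ Γ₁) (M : TM2ComputableAux Γ₁ Γ₂)

/-- The stack alphabets of the composition of `P` and `M`. -/
abbrev Alphabet : P.tm.K ⊕ M.tm.K → Type
  | .inl k => P.tm.Γ k
  | .inr k => M.tm.Γ k

/-- The labels of the composition: those of `P`, the copying loop `.inr none`, and those of `M`. -/
abbrev Label : Type := P.tm.Λ ⊕ Option M.tm.Λ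

/-- The internal states of the composition; the last component holds the symbol being copied. -/
abbrev Register : Type := P.tm.σ × M.tm.σ × Option (M.tm.Γ M.tm.k₀)

/-- A statement of `P` within the composition: halting becomes a jump to the copying loop. -/
def left : TM2.Stmt P.tm.Γ P.tm.Λ P.tm.σ → TM2.Stmt (Alphabet P M) (Label P M) (Register P M)
  | push k f q => push (.inl k) (fun v => f v.1) (left q)
  | peek k f q => peek (.inl k) (fun v a => (f v.1 a, v.2)) (left q)
  | pop k f q => pop (.inl k) (fun v a => (f v.1 a, v.2)) (left q)
  | load f q => load (fun v => (f v.1, v.2)) (left q)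
  | branch f q₁ q₂ => branch (fun v => f v.1) (left q₁) (left q₂)
  | goto f => goto fun v => .inl (f v.1)
  | halt => goto fun _ => .inr none

/-- A statement of `M` within the composition. -/
def right : TM2.Stmt M.tm.Γ M.tm.Λ M.tm.σ → TM2.Stmt (Alphabet P M) (Label P M) (Register P M)
  | push k f q => push (.inr k) (fun v => f v.2.1) (right q)
  | peek k f q => peek (.inr k) (fun v a => (v.1, f v.2.1 a, v.2.2)) (right q)
  | pop k f q => pop (.inr k) (fun v a => (v.1, f v.2.1 a, v.2.2)) (right q)
  | load f q => load (fun v => (v.1, f v.2.1, v.2.2)) (right q)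
  | branch f q₁ q₂ => branch (fun v => f v.2.1) (right q₁) (right q₂)
  | goto f => goto fun v => .inr (some (f v.2.1))
  | halt => halt

/-- The loop that moves the output of `P` to the input stack of `M`, reversing it. -/
def copy [Inhabited Γ₁] : TM2.Stmt (Alphabet P M) (Label P M) (Register P M) :=
  pop (.inl P.tm.k₁)
      (fun v a => (v.1, v.2.1, a.map fun x => M.inputAlphabet.symm (P.outputAlphabet x))) <|
    branch (fun v => v.2.2.isSome)
      (push (.inr M.tm.k₀) (fun v => v.2.2.getD (M.inputAlphabet.symm default))
        (goto fun _ => .inr none))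
      (goto fun _ => .inr (some M.tm.main))

/-- The program of the composition. -/
def program [Inhabited Γ₁] :
    Label P M → TM2.Stmt (Alphabet P M) (Label P M) (Register P M)
  | .inl l => left P M (P.tm.m l)
  | .inr none => copy P M
  | .inr (some l) => right P M (M.tm.m l)

end runThen

/-- The machine that runs `P`, hands its output, reversed, over to `M`, and runs `M`. -/
def runThen {Γ₀ Γ₁ Γ₂ : Type} [Inhabited Γ₁] (P : TM2ComputableAux Γ₀ Γ₁)
    (M : TM2ComputableAux Γ₁ Γ₂) : TM2ComputableAux Γ₀ Γ₂ where
  tm :=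
    { K := P.tm.K ⊕ M.tm.K
      kFin := @instFintypeSum _ _ P.tm.kFin M.tm.kFin
      k₀ := .inl P.tm.k₀
      k₁ := .inr M.tm.k₁
      Γ := runThen.Alphabet P M
      Λ := runThen.Label P M
      main := .inl P.tm.main
      ΛFin := @instFintypeSum _ _ P.tm.ΛFin (@instFintypeOption _ M.tm.ΛFin)
      σ := runThen.Register P M
      initialState := (P.tm.initialState, M.tm.initialState, none)
      σFin := @instFintypeProd _ _ P.tm.σFin
        (@instFintypeProd _ _ M.tm.σFin (@instFintypeOption _ M.tm.Γk₀Fin))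
      Γk₀Fin := P.tm.Γk₀Fin
      m := runThen.program P M }
  inputAlphabet := P.inputAlphabet
  outputAlphabet := M.outputAlphabet

namespace runThen

variable {Γ₀ Γ₁ Γ₂ : Type} {P : TM2ComputableAux Γ₀ Γ₁} {M : TM2ComputableAux Γ₁ Γ₂}

/-- The stacks of the composition. -/
def stk (S : ∀ k, List (P.tm.Γ k)) (S' : ∀ k, List (M.tm.Γ k)) : ∀ k, List (Alphabet P M k) :=
  Sum.rec S S'

@[simp]
theorem stk_inl (S : ∀ k, List (P.tm.Γ k)) (S' : ∀ k, List (M.tm.Γ k)) (k : P.tm.K) :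
    stk S S' (.inl k) = S k := rfl

@[simp]
theorem stk_inr (S : ∀ k, List (P.tm.Γ k)) (S' : ∀ k, List (M.tm.Γ k)) (k : M.tm.K) :
    stk S S' (.inr k) = S' k := rfl

@[simp]
theorem update_stk_inl (S : ∀ k, List (P.tm.Γ k)) (S' : ∀ k, List (M.tm.Γ k)) (k : P.tm.K)
    (s : List (P.tm.Γ k)) :
    Function.update (stk S S') (.inl k) s = stk (Function.update S k s) S' :=
  (Sum.rec_update_left (γ := fun k => List (Alphabet P M k)) S S' k s).symm

@[simp]
theorem update_stk_inr (S : ∀ k, List (P.tm.Γ k)) (S' : ∀ k, List (M.tm.Γ k)) (k : M.tm.K)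
    (s : List (M.tm.Γ k)) :
    Function.update (stk S S') (.inr k) s = stk S (Function.update S' k s) :=
  (Sum.rec_update_right (γ := fun k => List (Alphabet P M k)) S S' k s).symm

@[simp]
theorem stk_nil :
    stk (fun _ => []) (fun _ => []) = (fun _ => [] : ∀ k, List (Alphabet P M k)) := by
  funext k
  cases k <;> rfl

/-- A configuration of `P` within the composition. -/
def leftCfg (c : TM2.Cfg P.tm.Γ P.tm.Λ P.tm.σ) :
    TM2.Cfg (Alphabet P M) (Label P M) (Register P M) :=
  ⟨some (c.l.elim (.inr none) .inl), (c.var, M.tm.initialState, none), stk c.stk fun _ => []⟩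

/-- A configuration of `M` within the composition. -/
def rightCfg (c : TM2.Cfg M.tm.Γ M.tm.Λ M.tm.σ) :
    TM2.Cfg (Alphabet P M) (Label P M) (Register P M) :=
  ⟨c.l.map fun l => .inr (some l), (P.tm.initialState, c.var, none), stk (fun _ => []) c.stk⟩

theorem stepAux_left (q : TM2.Stmt P.tm.Γ P.tm.Λ P.tm.σ) (v : P.tm.σ)
    (S : ∀ k, List (P.tm.Γ k)) :
    TM2.stepAux (left P M q) (v, M.tm.initialState, none) (stk S fun _ => []) =
      leftCfg (TM2.stepAux q v S) := by
  induction q generalizing v S with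
  | push k f _ ih | pop k f _ ih => simpa [left] using ih _ _
  | peek k f _ ih | load f _ ih => exact ih _ _
  | branch f q₁ q₂ ih₁ ih₂ => cases h : f v <;> simp [left, h, ih₁, ih₂]
  | goto f => rfl
  | halt => rfl

theorem stepAux_right (q : TM2.Stmt M.tm.Γ M.tm.Λ M.tm.σ) (v : M.tm.σ)
    (S : ∀ k, List (M.tm.Γ k)) :
    TM2.stepAux (right P M q) (P.tm.initialState, v, none) (stk (fun _ => []) S) =
      rightCfg (TM2.stepAux q v S) := by
  induction q generalizing v S with
  | push k f _ ih | pop k f _ ih => simpa [right] using ih _ _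
  | peek k f _ ih | load f _ ih => exact ih _ _
  | branch f q₁ q₂ ih₁ ih₂ => cases h : f v <;> simp [right, h, ih₁, ih₂]
  | goto f => rfl
  | halt => rfl

variable [Inhabited Γ₁]

theorem step_leftCfg (c c' : TM2.Cfg P.tm.Γ P.tm.Λ P.tm.σ) (h : TM2.step P.tm.m c = some c') :
    TM2.step (program P M) (leftCfg c) = some (leftCfg c') := by
  obtain ⟨_ | l, v, S⟩ := c
  · cases h
  · obtain rfl := Option.some.inj h
    exact congrArg some (stepAux_left _ _ _)

theorem step_rightCfg (c c' : TM2.Cfg M.tm.Γ M.tm.Λ M.tm.σ) (h : TM2.step M.tm.m c = some c') :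
    TM2.step (program P M) (rightCfg c) = some (rightCfg c') := by
  obtain ⟨_ | l, v, S⟩ := c
  · cases h
  · obtain rfl := Option.some.inj h
    exact congrArg some (stepAux_right _ _ _)

theorem reachesWithin_copy (s : List (P.tm.Γ P.tm.k₁)) (s' : List (M.tm.Γ M.tm.k₀))
    (o : Option (M.tm.Γ M.tm.k₀)) :
    ReachesWithin (TM2.step (program P M)) (s.length + 1)
      ⟨some (.inr none), (P.tm.initialState, M.tm.initialState, o),
        stk (Function.update (fun _ => []) P.tm.k₁ s)
          (Function.update (fun _ => []) M.tm.k₀ s')⟩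
      (rightCfg ⟨some M.tm.main, M.tm.initialState, Function.update (fun _ => []) M.tm.k₀
        ((s.reverse.map fun x => M.inputAlphabet.symm (P.outputAlphabet x)) ++ s')⟩) := by
  induction s generalizing s' o with
  | nil => exact .single (by simp [program, copy, rightCfg])
  | cons a s ih =>
    have hs := ih (M.inputAlphabet.symm (P.outputAlphabet a) :: s')
      (some (M.inputAlphabet.symm (P.outputAlphabet a)))
    refine .head ?_ (by simpa using hs)
    simp [program, copy]

end runThen

theorem OutputsWithin.comp {Γ₀ Γ₁ Γ₂ : Type} [Inhabited Γ₁] {P : TM2ComputableAux Γ₀ Γ₁}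
    {M : TM2ComputableAux Γ₁ Γ₂} {T T' : ℕ} {s : List Γ₀} {w : List Γ₁} {s' : List Γ₂}
    (hP : OutputsWithin P T s w.reverse) (hM : OutputsWithin M T' w s') :
    OutputsWithin (runThen P M) (T + (w.length + 1) + T') s s' := by
  rw [outputsWithin_iff_reachesWithin] at hP hM ⊢
  have runP := hP.map (runThen.leftCfg (M := M)) runThen.step_leftCfg
  have runCopy := runThen.reachesWithin_copy (P := P) (M := M)
    (w.reverse.map P.outputAlphabet.symm) [] none
  have runM := hM.map (runThen.rightCfg (P := P)) runThen.step_rightCfg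
  simp only [List.map_reverse, List.reverse_reverse, List.map_map, List.length_reverse,
    List.length_map, List.append_nil, Function.comp_def, Equiv.apply_symm_apply,
    Function.update_eq_self (f := fun _ => [])] at runP runCopy runM
  have run := (runP.trans runCopy).trans runM
  simp only [runThen.leftCfg, runThen.rightCfg, Option.elim, Option.map,
    ← runThen.update_stk_inl, ← runThen.update_stk_inr, runThen.stk_nil] at run
  exact run

namespace SolvableInTime

variable {ι κ : Type} {enc : ι → List (Option Bool)} {enc' : κ → List (Option Bool)}
  {valid yes : ι → Prop} {valid' yes' : κ → Prop} {bound bound' : ι → ℝ}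

theorem mono (h : SolvableInTime enc valid yes bound)
    (hbound : ∀ x, valid x → bound x ≤ bound' x) : SolvableInTime enc valid yes bound' :=
  h.imp fun _ hM x hx => (hM x hx).imp fun _ hT => ⟨hT.1.trans (hbound x hx), hT.2⟩

/-- The preprocessing machine writes the instance backwards because handing it over reverses it. -/
theorem of_reduction {P : TM2ComputableAux (Option Bool) (Option Bool)} {reduce : κ → ι}
    {time : κ → ℕ}
    (hP : ∀ y, valid' y → OutputsWithin P (time y) (enc' y) (enc (reduce y)).reverse)
    (hvalid : ∀ y, valid' y → valid (reduce y))
    (hyes : ∀ y, valid' y → (yes (reduce y) ↔ yes' y))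
    (h : SolvableInTime enc valid yes bound) :
    SolvableInTime enc' valid' yes'
      fun y => time y + ((enc (reduce y)).length + 1) + bound (reduce y) := by
  obtain ⟨M, hM⟩ := h
  refine ⟨runThen P M, fun y hy => ?_⟩
  obtain ⟨T, hT, run⟩ := hM (reduce y) (hvalid y hy)
  refine ⟨time y + ((enc (reduce y)).length + 1) + T, by push_cast; gcongr, ?_⟩
  rw [decide_eq_decide.2 (hyes y hy)] at run
  exact (hP y hy).comp run

end SolvableInTime

/-! ### A machine that compares all pairs of a list of descriptors -/

/-- A tag followed by a string of symbols. The graphs of the reduction have descriptors as vertices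
and are written down by comparing all pairs of descriptors. -/
structure Descriptor (τ α : Type) where
  tag : τ
  symbols : List α

/-- The concatenation of a list of descriptors, as a string over tags and symbols. -/
def Descriptor.tokens {τ α : Type} (D : List (Descriptor τ α)) : List (τ ⊕ α) :=
  D.flatMap fun d => .inl d.tag :: d.symbols.map .inr

/-- A Boolean test for pairs of descriptors that can be evaluated in one simultaneous pass. -/
structure PairTest (τ α : Type) where
  /-- the part of the test that depends on the tags only -/
  base : τ → τ → Bool
  /-- the test for two symbols at equal positions, given the tags -/
  sym : τ → τ → α → α → Bool
  /-- whether descriptors with this tag are counted -/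
  counted : τ → Bool

/-- Push the letters of a string one after the other. -/
def pushList {K : Type} {Γ : K → Type} {Λ σ : Type} (k : K) :
    List (Γ k) → TM2.Stmt Γ Λ σ → TM2.Stmt Γ Λ σ
  | [], q => q
  | a :: l, q => .push k (fun _ => a) (pushList k l q)

@[simp]
theorem stepAux_pushList {K : Type} [DecidableEq K] {Γ : K → Type} {Λ σ : Type}
    (k : K) (l : List (Γ k)) (q : TM2.Stmt Γ Λ σ) (v : σ) (S : ∀ k, List (Γ k)) :
    TM2.stepAux (pushList k l q) v S =
      TM2.stepAux q v (Function.update S k (l.reverse ++ S k)) := by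
  induction l generalizing S with
  | nil => simp [pushList]
  | cons a l ih => simp [pushList, ih]

namespace Descriptor

variable {τ α : Type}

@[simp]
theorem tokens_nil : tokens ([] : List (Descriptor τ α)) = [] := rfl

@[simp]
theorem tokens_cons (d : Descriptor τ α) (D : List (Descriptor τ α)) :
    tokens (d :: D) = .inl d.tag :: (d.symbols.map .inr ++ tokens D) := rfl

theorem tokens_append (D E : List (Descriptor τ α)) : tokens (D ++ E) = tokens D ++ tokens E :=
  List.flatMap_append

/-- The tag at the head of a string of tokens, given its first letter. -/
def tag? (x : Option (τ ⊕ α)) : Option τ :=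
  x.bind Sum.getLeft?

/-- The symbol at the head of a string of tokens, given its first letter. -/
def sym? (x : Option (τ ⊕ α)) : Option α :=
  x.bind Sum.getRight?

@[simp]
theorem tag?_inl (x : τ) : tag? (some (.inl x : τ ⊕ α)) = some x := rfl

@[simp]
theorem tag?_inr (a : α) : tag? (some (.inr a : τ ⊕ α)) = none := rfl

@[simp]
theorem sym?_none : sym? (none : Option (τ ⊕ α)) = none := rfl

@[simp]
theorem sym?_inl (x : τ) : sym? (some (.inl x : τ ⊕ α)) = none := rfl

@[simp]
theorem sym?_inr (a : α) : sym? (some (.inr a : τ ⊕ α)) = some a := rfl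

theorem sym?_head?_tokens (D : List (Descriptor τ α)) : sym? (tokens D).head? = none := by
  cases D <;> simp

theorem countP_tokens (f : τ → Bool) (D : List (Descriptor τ α)) :
    (tokens D).countP (fun x => (tag? (some x)).any f) = D.countP fun d => f d.tag := by
  induction D with
  | nil => rfl
  | cons d D ih =>
    cases h : f d.tag <;> simp [h, ih, List.countP_map, Function.comp_def]

end Descriptor

namespace PairTest

open Descriptor TM2.Stmt

variable {τ α : Type} (p : PairTest τ α)

/-- The outcome of the comparison of two descriptors. -/
def eval (d e : Descriptor τ α) : Bool :=
  p.base d.tag e.tag || (d.symbols.zip e.symbols).any fun x => p.sym d.tag e.tag x.1 x.2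

/-- What the machine writes: `t`, the number of counted descriptors and the number of all
descriptors, in unary, followed by the outcomes of all comparisons. This is the layout of
`ClubInstance.encode`. -/
def report (t : ℕ) (D : List (Descriptor τ α)) : List (Option Bool) :=
  encodeUnary t ++ encodeUnary (D.countP fun d => p.counted d.tag) ++ encodeUnary D.length ++
    D.flatMap fun d => D.map fun e => some (p.eval d e)

/-- The stacks: input, three work copies of the list, the symbols of the current row that are yet
to be compared and those already compared, and the output. -/
inductive Stack
  | inp | rev | todo | done | ahead | behind | out
  deriving DecidableEq

instance : Fintype Stack :=
  ⟨{.inp, .rev, .todo, .done, .ahead, .behind, .out}, by rintro ⟨⟩ <;> simp⟩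

/-- The labels of the program. -/
inductive Label
  | start | countSome | countAll | row | readRow | rewind | column | compare | restore | clear
  | finish
  deriving DecidableEq

instance : Fintype Label :=
  ⟨{.start, .countSome, .countAll, .row, .readRow, .rewind, .column, .compare, .restore, .clear,
    .finish}, by rintro ⟨⟩ <;> simp⟩

/-- The stack alphabets. -/
abbrev Alphabet (τ α : Type) : Stack → Type
  | .inp | .rev | .todo | .done => τ ⊕ α
  | .ahead | .behind => α
  | .out => Option Bool

/-- The registers: the last token read, the last symbol read, the tags of the current row and
column, and the outcome so far. -/
structure Register (τ α : Type) where
  tok : Option (τ ⊕ α) := none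
  chr : Option α := none
  rowTag : Option τ := none
  colTag : Option τ := none
  acc : Bool := false
  deriving Fintype

/-- The test on the two tags in the registers. -/
def baseTest : Option τ → Option τ → Bool
  | some x, some y => p.base x y
  | _, _ => false

/-- The test on the row symbol `a` and the column symbol in the registers. -/
def symTest (r : Register τ α) (a : α) : Bool :=
  match r.rowTag, r.colTag, sym? r.tok with
  | some x, some y, some b => p.sym x y a b
  | _, _, _ => false

/-- The stacks with the given contents. -/
@[simp]
def stk (inp rev todo done : List (τ ⊕ α)) (ahead behind : List α) (out : List (Option Bool)) :
    ∀ k, List (Alphabet τ α k)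
  | .inp => inp
  | .rev => rev
  | .todo => todo
  | .done => done
  | .ahead => ahead
  | .behind => behind
  | .out => out

section Stack

variable (i r u d : List (τ ⊕ α)) (a b : List α) (o : List (Option Bool))

@[simp]
theorem update_stk_inp (x) :
    Function.update (stk i r u d a b o) .inp x = stk x r u d a b o := by
  funext k; cases k <;> rfl

@[simp]
theorem update_stk_rev (x) :
    Function.update (stk i r u d a b o) .rev x = stk i x u d a b o := by
  funext k; cases k <;> rfl

@[simp]
theorem update_stk_todo (x) :
    Function.update (stk i r u d a b o) .todo x = stk i r x d a b o := by
  funext k; cases k <;> rfl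

@[simp]
theorem update_stk_done (x) :
    Function.update (stk i r u d a b o) .done x = stk i r u x a b o := by
  funext k; cases k <;> rfl

@[simp]
theorem update_stk_ahead (x) :
    Function.update (stk i r u d a b o) .ahead x = stk i r u d x b o := by
  funext k; cases k <;> rfl

@[simp]
theorem update_stk_behind (x) :
    Function.update (stk i r u d a b o) .behind x = stk i r u d a x o := by
  funext k; cases k <;> rfl

@[simp]
theorem update_stk_out (x) :
    Function.update (stk i r u d a b o) .out x = stk i r u d a b x := by
  funext k; cases k <;> rfl

theorem update_nil_inp :
    (Function.update (fun _ => []) .inp i : ∀ k, List (Alphabet τ α k)) =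
      stk i [] [] [] ([] : List α) [] [] := by
  funext k; cases k <;> rfl

theorem update_nil_out :
    (Function.update (fun _ => []) .out o : ∀ k, List (Alphabet τ α k)) =
      stk ([] : List (τ ⊕ α)) [] [] [] [] [] o := by
  funext k; cases k <;> rfl

end Stack

variable [Inhabited α] (t : ℕ)

/-- The program. The input is copied twice while the first two loops count; then every descriptor
in turn is read into `behind` and compared with all descriptors in `todo`. The values `default` are
never pushed. -/
def program : Label → TM2.Stmt (Alphabet τ α) Label (Register τ α)
  | .start => pushList .out (encodeUnary t) (goto fun _ => .countSome)
  | .countSome => pop .inp (fun r a => { r with tok := a }) <|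
      branch (fun r => r.tok.isSome)
        (push .rev (fun r => r.tok.getD default) <|
          branch (fun r => (tag? r.tok).any p.counted)
            (push .out (fun _ => some true) (goto fun _ => .countSome))
            (goto fun _ => .countSome))
        (push .out (fun _ => none) (goto fun _ => .countAll))
  | .countAll => pop .rev (fun r a => { r with tok := a }) <|
      branch (fun r => r.tok.isSome)
        (push .inp (fun r => r.tok.getD default) <| push .todo (fun r => r.tok.getD default) <|
          branch (fun r => (tag? r.tok).isSome)
            (push .out (fun _ => some true) (goto fun _ => .countAll))
            (goto fun _ => .countAll))
        (push .out (fun _ => none) (goto fun _ => .row))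
  | .row => pop .inp (fun r a => { r with tok := a }) <|
      branch (fun r => r.tok.isSome)
        (load (fun r => { r with rowTag := tag? r.tok }) (goto fun _ => .readRow))
        (goto fun _ => .finish)
  | .readRow => peek .inp (fun r a => { r with tok := a }) <|
      branch (fun r => (sym? r.tok).isSome)
        (pop .inp (fun r _ => r) <| push .behind (fun r => (sym? r.tok).getD default) <|
          goto fun _ => .readRow)
        (goto fun _ => .rewind)
  | .rewind => pop .behind (fun r a => { r with chr := a }) <|
      branch (fun r => r.chr.isSome)
        (push .ahead (fun r => r.chr.getD default) (goto fun _ => .rewind))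
        (goto fun _ => .column)
  | .column => pop .todo (fun r a => { r with tok := a }) <|
      branch (fun r => r.tok.isSome)
        (push .done (fun r => r.tok.getD default) <|
          load (fun r => { r with
            colTag := tag? r.tok, acc := p.baseTest r.rowTag (tag? r.tok) }) <|
          goto fun _ => .compare)
        (goto fun _ => .restore)
  | .compare => peek .todo (fun r a => { r with tok := a }) <|
      branch (fun r => (sym? r.tok).isSome)
        (pop .todo (fun r _ => r) <| push .done (fun r => r.tok.getD default) <|
          pop .ahead (fun r a => { r with chr := a, acc := r.acc || a.any (p.symTest r) }) <|
          branch (fun r => r.chr.isSome)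
            (push .behind (fun r => r.chr.getD default) (goto fun _ => .compare))
            (goto fun _ => .compare))
        (push .out (fun r => some r.acc) <| load (fun r => { r with chr := none }) <|
          goto fun _ => .rewind)
  | .restore => pop .done (fun r a => { r with tok := a }) <|
      branch (fun r => r.tok.isSome)
        (push .todo (fun r => r.tok.getD default) (goto fun _ => .restore))
        (goto fun _ => .clear)
  | .clear => pop .ahead (fun r a => { r with chr := a }) <|
      branch (fun r => r.chr.isSome) (goto fun _ => .clear) (goto fun _ => .row)
  | .finish => pop .todo (fun r a => { r with tok := a }) <|
      branch (fun r => r.tok.isSome) (goto fun _ => .finish) (load (fun _ => {}) halt)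

/-- The machine that, given a list of descriptors, writes the report of `p`, backwards. -/
def machine [Fintype τ] [Fintype α] : TM2ComputableAux (τ ⊕ α) (Option Bool) where
  tm :=
    { K := Stack
      k₀ := .inp
      k₁ := .out
      Γ := Alphabet τ α
      Λ := Label
      main := .start
      σ := Register τ α
      initialState := {}
      Γk₀Fin := inferInstanceAs (Fintype (τ ⊕ α))
      m := p.program t }
  inputAlphabet := .refl _
  outputAlphabet := .refl _

/-- Bounded reachability between running configurations of the program. -/
abbrev Reach (T : ℕ) (l : Label) (r : Register τ α) (S : ∀ k, List (Alphabet τ α k)) (l' : Label)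
    (r' : Register τ α) (S' : ∀ k, List (Alphabet τ α k)) : Prop :=
  ReachesWithin (TM2.step (p.program t)) T ⟨some l, r, S⟩ ⟨some l', r', S'⟩

theorem reach_countSome (w i' : List (τ ⊕ α)) (u d a b o) (r : Register τ α) :
    p.Reach t (w.length + 1) .countSome r (stk w i' u d a b o)
      .countAll { r with tok := none }
      (stk [] (w.reverse ++ i') u d a b
        (none :: (List.replicate (w.countP fun x => (tag? (some x)).any p.counted) (some true)
          ++ o))) := by
  induction w generalizing i' o r with
  | nil => exact .single (by simp [program])
  | cons x w ih =>
    by_cases hx : (tag? (some x)).any p.counted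
    · have hw := ih (x :: i') (some true :: o) { r with tok := some x }
      refine .head ?_ (by simpa [hx, List.replicate_succ'] using hw)
      simp [program, hx]
    · refine .head ?_ (by simpa [hx] using ih (x :: i') o { r with tok := some x })
      simp [program, hx]

theorem reach_countAll (w i u d : List (τ ⊕ α)) (a b o) (r : Register τ α) :
    p.Reach t (w.length + 1) .countAll r (stk i w u d a b o)
      .row { r with tok := none }
      (stk (w.reverse ++ i) [] (w.reverse ++ u) d a b
        (none :: (List.replicate (w.countP fun x => (tag? (some x)).isSome) (some true)
          ++ o))) := by
  induction w generalizing i u o r with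
  | nil => exact .single (by simp [program])
  | cons x w ih =>
    by_cases hx : (tag? (some x)).isSome
    · have hw := ih (x :: i) (x :: u) (some true :: o) { r with tok := some x }
      refine .head ?_ (by simpa [hx, List.replicate_succ'] using hw)
      simp [program, hx]
    · refine .head ?_ (by simpa [hx] using ih (x :: i) (x :: u) o { r with tok := some x })
      simp [program, hx]

theorem reach_readRow (v b : List α) (w v' u d : List (τ ⊕ α)) (a o) (r : Register τ α)
    (hw : sym? w.head? = none) :
    p.Reach t (v.length + 1) .readRow r (stk (v.map .inr ++ w) v' u d a b o)
      .rewind { r with tok := w.head? } (stk w v' u d a (v.reverse ++ b) o) := by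
  induction v generalizing b r with
  | nil => exact .single (by simp [program, hw])
  | cons x v ih =>
    refine .head ?_ (by simpa using ih (x :: b) { r with tok := some (.inr x) })
    simp [program]

theorem reach_rewind (v a : List α) (i v' u d : List (τ ⊕ α)) (o) (r : Register τ α) :
    p.Reach t (v.length + 1) .rewind r (stk i v' u d a v o)
      .column { r with chr := none } (stk i v' u d (v.reverse ++ a) [] o) := by
  induction v generalizing a r with
  | nil => exact .single (by simp [program])
  | cons x v ih =>
    refine .head ?_ (by simpa using ih (x :: a) { r with chr := some x })
    simp [program]

theorem reach_restore (w i v' u : List (τ ⊕ α)) (a b o) (r : Register τ α) :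
    p.Reach t (w.length + 1) .restore r (stk i v' u w a b o)
      .clear { r with tok := none } (stk i v' (w.reverse ++ u) [] a b o) := by
  induction w generalizing u r with
  | nil => exact .single (by simp [program])
  | cons x w ih =>
    refine .head ?_ (by simpa using ih (x :: u) { r with tok := some x })
    simp [program]

theorem reach_clear (v : List α) (i v' u d : List (τ ⊕ α)) (b o) (r : Register τ α) :
    p.Reach t (v.length + 1) .clear r (stk i v' u d v b o)
      .row { r with chr := none } (stk i v' u d [] b o) := by
  induction v generalizing r with
  | nil => exact .single (by simp [program])
  | cons x v ih =>
    refine .head ?_ (by simpa using ih { r with chr := some x })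
    simp [program]

theorem reachesWithin_finish (w i v' d : List (τ ⊕ α)) (a b o) (r : Register τ α) :
    ReachesWithin (TM2.step (p.program t)) (w.length + 1)
      ⟨some .finish, r, stk i v' w d a b o⟩ ⟨none, {}, stk i v' [] d a b o⟩ := by
  induction w generalizing r with
  | nil => exact .single (by simp [program])
  | cons x w ih =>
    refine .head ?_ (by simpa using ih { r with tok := some x })
    simp [program]

theorem reach_compare {x y : τ} (v a b : List α) {w : List (τ ⊕ α)} (i v' d o) (r : Register τ α)
    (hw : sym? w.head? = none) (hx : r.rowTag = some x) (hy : r.colTag = some y) :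
    p.Reach t (v.length + 1) .compare r (stk i v' (v.map .inr ++ w) d a b o)
      .rewind { r with
        tok := w.head?
        chr := none
        acc := r.acc || (a.zip v).any fun z => p.sym x y z.1 z.2 }
      (stk i v' w ((v.map .inr).reverse ++ d) (a.drop v.length)
        ((a.take v.length).reverse ++ b)
        (some (r.acc || (a.zip v).any fun z => p.sym x y z.1 z.2) :: o)) := by
  induction v generalizing a b d r with
  | nil => exact .single (by simp [program, hw])
  | cons c v ih =>
    cases a with
    | nil =>
      have hv := ih [] b (.inr c :: d) { r with tok := some (.inr c), chr := none } hx hy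
      refine .head ?_ (by simpa using hv)
      simp [program]
    | cons e a =>
      have hv := ih a (e :: b) (.inr c :: d)
        { r with tok := some (.inr c), chr := some e, acc := r.acc || p.sym x y e c } hx hy
      refine .head ?_ (by simpa [Bool.or_assoc] using hv)
      simp [program, symTest, hx, hy]

theorem reach_column {x : τ} (e : Descriptor τ α) (E : List (Descriptor τ α)) (i v' d a o)
    (r : Register τ α) (hx : r.rowTag = some x) :
    ∃ r', r'.rowTag = some x ∧
    p.Reach t ((tokens [e]).length + a.length + 2) .column r
      (stk i v' (tokens (e :: E)) d a [] o) .column r'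
      (stk i v' (tokens E) ((tokens [e]).reverse ++ d) a [] (some (p.eval ⟨x, a⟩ e) :: o)) := by
  have compared := p.reach_compare t e.symbols a [] i v' (.inl e.tag :: d) o
    { r with tok := some (.inl e.tag), colTag := some e.tag, acc := p.base x e.tag }
    (sym?_head?_tokens E) hx rfl
  have rewound := compared.trans (p.reach_rewind t ..)
  refine ⟨_, ?_, ReachesWithin.mono (.head (b := ⟨some .compare, _, _⟩) ?_
    (by simpa [eval] using rewound)) ?_⟩
  · exact hx
  · simp [program, hx, baseTest]
  · simp only [tokens_cons, tokens_nil, List.append_nil, List.length_cons, List.length_map]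
    omega

theorem reach_columns {x : τ} (E : List (Descriptor τ α)) (i v' d a o) (r : Register τ α)
    (hx : r.rowTag = some x) :
    ∃ r', p.Reach t ((tokens E).length + E.length * (a.length + 2) + 1) .column r
      (stk i v' (tokens E) d a [] o) .restore r'
      (stk i v' [] ((tokens E).reverse ++ d) a []
        ((E.map fun e => some (p.eval ⟨x, a⟩ e)).reverse ++ o)) := by
  induction E generalizing d o r with
  | nil => exact ⟨{ r with tok := none }, .mono (.single (by simp [program])) (by simp)⟩
  | cons e E ih =>
    obtain ⟨r₁, hr₁, first⟩ := p.reach_column t e E i v' d a o r hx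
    obtain ⟨r₂, rest⟩ := ih ((tokens [e]).reverse ++ d) (some (p.eval ⟨x, a⟩ e) :: o) r₁ hr₁
    refine ⟨r₂, .mono (by simpa using first.trans rest) ?_⟩
    simp only [tokens_cons, List.length_cons, List.length_append, List.length_map, add_one_mul]
    omega

theorem reach_row (d : Descriptor τ α) (D E : List (Descriptor τ α)) (o) (r : Register τ α) :
    ∃ r', p.Reach t
      (3 * d.symbols.length + 2 * (tokens E).length + E.length * (d.symbols.length + 2) + 6)
      .row r (stk (tokens (d :: D)) [] (tokens E) [] [] [] o) .row r'
      (stk (tokens D) [] (tokens E) [] [] []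
        ((E.map fun e => some (p.eval d e)).reverse ++ o)) := by
  have read := p.reach_readRow t d.symbols [] (tokens D) [] (tokens E) [] [] o
    { tok := some (.inl d.tag), chr := r.chr, rowTag := some d.tag, colTag := r.colTag,
      acc := r.acc } (sym?_head?_tokens D)
  have rewound := read.trans (p.reach_rewind t ..)
  obtain ⟨r', compared⟩ := p.reach_columns t (x := d.tag) E (tokens D) [] [] d.symbols o
    { tok := (tokens D).head?, chr := none, rowTag := some d.tag, colTag := r.colTag,
      acc := r.acc } rfl
  simp only [List.append_nil, List.reverse_reverse] at rewound compared
  have cleared := ((rewound.trans compared).trans (p.reach_restore t ..)).trans (p.reach_clear t ..)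
  simp only [List.append_nil, List.reverse_reverse] at cleared
  refine ⟨_, .mono (.head ?_ cleared) ?_⟩
  · simp [program]
  · simp only [List.length_reverse]
    omega

theorem reach_rows (D E : List (Descriptor τ α)) {B : ℕ} (hB : ∀ d ∈ D, d.symbols.length ≤ B)
    (o) (r : Register τ α) :
    ∃ r', p.Reach t (D.length * (3 * B + 2 * (tokens E).length + E.length * (B + 2) + 6) + 1)
      .row r (stk (tokens D) [] (tokens E) [] [] [] o) .finish r'
      (stk [] [] (tokens E) [] [] []
        ((D.flatMap fun d => E.map fun e => some (p.eval d e)).reverse ++ o)) := by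
  induction D generalizing o r with
  | nil => exact ⟨{ r with tok := none }, .mono (.single (by simp [program])) (by simp)⟩
  | cons d D ih =>
    obtain ⟨r₁, first⟩ := p.reach_row t d D E o r
    obtain ⟨r₂, rest⟩ := ih (fun d hd => hB d (List.mem_cons_of_mem _ hd))
      ((E.map fun e => some (p.eval d e)).reverse ++ o) r₁
    refine ⟨r₂, .mono (by simpa using first.trans rest) ?_⟩
    have hd := hB d List.mem_cons_self
    have := Nat.mul_le_mul_left E.length (Nat.add_le_add_right hd 2)
    rw [List.length_cons, add_one_mul]
    omega

theorem reach_counted (D : List (Descriptor τ α)) :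
    p.Reach t (2 * (tokens D).length + 3) .start {} (stk (tokens D) [] [] [] [] [] []) .row {}
      (stk (tokens D) [] (tokens D) [] [] []
        (encodeUnary t ++ encodeUnary (D.countP fun d => p.counted d.tag) ++
          encodeUnary D.length).reverse) := by
  have counted := (p.reach_countSome t (tokens D) [] [] [] [] [] (encodeUnary t).reverse {}).trans
    (p.reach_countAll t ..)
  have hall : (tokens D).countP (fun x => (tag? (some x)).isSome) = D.length := by
    simpa [Option.any_true] using countP_tokens (fun _ => true) D
  refine .mono (.head (b := ⟨some .countSome, {},
    stk (tokens D) [] [] [] [] [] (encodeUnary t).reverse⟩) (by simp [program])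
      (by simpa [encodeUnary, countP_tokens, hall] using counted)) ?_
  omega

theorem outputsWithin_report [Fintype τ] [Fintype α] (D : List (Descriptor τ α)) {B : ℕ}
    (hB : ∀ d ∈ D, d.symbols.length ≤ B) :
    OutputsWithin (p.machine t)
      (D.length * (3 * B + 2 * (tokens D).length + D.length * (B + 2) + 6) +
        3 * (tokens D).length + 5) (tokens D) (p.report t D).reverse := by
  obtain ⟨r, compared⟩ := p.reach_rows t D D hB (encodeUnary t ++
    encodeUnary (D.countP fun d => p.counted d.tag) ++ encodeUnary D.length).reverse {}
  have run := ((p.reach_counted t D).trans compared).trans (p.reachesWithin_finish t ..)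
  rw [← List.reverse_append, ← update_nil_inp, ← update_nil_out] at run
  rw [outputsWithin_iff_reachesWithin]
  have inp_eq : (tokens D).map (p.machine t).inputAlphabet.symm = tokens D := List.map_id _
  have out_eq : (p.report t D).reverse.map (p.machine t).outputAlphabet.symm =
    (p.report t D).reverse := List.map_id _
  rw [inp_eq, out_eq]
  refine ReachesWithin.mono run ?_
  omega

end PairTest

/-! ### A machine that turns a formula into a list of descriptors -/

/-- The tags for the descriptors of the literals and the clauses of a formula, and the tags of
further descriptors, without symbols. -/
structure FormulaTags (τ : Type) where
  lit : Bool → τ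
  clause : Bool → τ
  extra : List τ

namespace FormulaTags

open Descriptor TM2.Stmt

variable {τ : Type} {N : ℕ}

/-- The entries `f` with the occurrences of literals in `c` added. The entry of a variable tells
which of its two literals occur. -/
def record (c : List (Fin N × Bool)) (f : Fin N → Bool × Bool) (p : Fin N) : Bool × Bool :=
  ((f p).1 || decide ((p, true) ∈ c), (f p).2 || decide ((p, false) ∈ c))

/-- The list of entries that describes the variable with index `i`. -/
def unitVector (N i : ℕ) : List (Bool × Bool) :=
  (List.range N).reverse.map fun p => (decide (p = i), decide (p = i))

/-- The list of entries that describes a clause. -/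
def clauseVector (c : List (Fin N × Bool)) : List (Bool × Bool) :=
  (List.finRange N).reverse.map (record c fun _ => (false, false))

/-- Two descriptors that share their symbols. -/
def twoCopies (tag : Bool → τ) (v : List (Bool × Bool)) : List (Descriptor τ (Bool × Bool)) :=
  [⟨tag true, v⟩, ⟨tag false, v⟩]

variable (g : FormulaTags τ)

/-- The list of descriptors for a formula: two for each variable and two for each clause. -/
def descriptors (F : CNFFormula) : List (Descriptor τ (Bool × Bool)) :=
  (List.range F.numVars).reverse.flatMap (fun i => twoCopies g.lit (unitVector F.numVars i)) ++
    F.clauses.flatMap (fun c => twoCopies g.clause (clauseVector c)) ++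
    g.extra.map fun x => ⟨x, []⟩

section Vectors

theorem unitVector_succ (N i : ℕ) :
    unitVector (N + 1) i = (decide (N = i), decide (N = i)) :: unitVector N i := by
  simp [unitVector, List.range_succ]

theorem unitVector_succ_zero (N : ℕ) :
    unitVector (N + 1) 0 = List.replicate N (false, false) ++ [(true, true)] := by
  induction N with
  | zero => rfl
  | succ N ih => rw [unitVector_succ, ih]; simp [List.replicate_succ]

theorem unitVector_succ_succ (N i : ℕ) :
    unitVector (N + 1) (i + 1) = unitVector N i ++ [(false, false)] := by
  simp [unitVector, List.range_succ_eq_map, Function.comp_def]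

theorem unitVector_of_le {N i : ℕ} (h : N ≤ i) :
    unitVector N i = List.replicate N (false, false) := by
  induction N with
  | zero => rfl
  | succ N ih => simp [unitVector_succ, ih (by omega), show N ≠ i by omega, List.replicate_succ]

@[simp]
theorem length_unitVector (N i : ℕ) : (unitVector N i).length = N := by
  simp [unitVector]

@[simp]
theorem length_clauseVector (c : List (Fin N × Bool)) : (clauseVector c).length = N := by
  simp [clauseVector]

theorem record_nil (f : Fin N → Bool × Bool) : record [] f = f := by
  funext p
  simp [record]

theorem record_cons (l : Fin N × Bool) (c : List (Fin N × Bool)) (f : Fin N → Bool × Bool) :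
    record (l :: c) f = record c (record [l] f) := by
  funext p
  simp [record, Bool.or_assoc]

/-- Add an occurrence of the literal with the given sign to an entry. -/
def mark : Bool → Bool × Bool → Bool × Bool
  | true, s => (true, s.2)
  | false, s => (s.1, true)

theorem modify_map_finRange (l : Fin N × Bool) (f : Fin N → Bool × Bool) :
    ((List.finRange N).map f).modify l.1 (mark l.2) = (List.finRange N).map (record [l] f) := by
  obtain ⟨k, b⟩ := l
  refine List.ext_getElem (by simp) fun p _ _ => ?_
  simp only [List.getElem_modify, List.getElem_map, List.getElem_finRange, record]
  split_ifs with h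
  · subst h
    cases b <;> simp [mark]
  · simp [Fin.ext_iff, Ne.symm h]

end Vectors

/-- The stacks: input, the current list of entries, two work copies of it, and the output. -/
inductive Stack
  | inp | vec | rev | dup | out
  deriving DecidableEq

instance : Fintype Stack :=
  ⟨{.inp, .vec, .rev, .dup, .out}, by rintro ⟨⟩ <;> simp⟩

/-- The labels of the program. -/
inductive Label
  | readCount | copy | emit | emitDup | clause | walk | back | finish
  deriving DecidableEq

instance : Fintype Label :=
  ⟨{.readCount, .copy, .emit, .emitDup, .clause, .walk, .back, .finish}, by rintro ⟨⟩ <;> simp⟩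

/-- The stack alphabets. -/
abbrev Alphabet (τ : Type) : Stack → Type
  | .inp => Option Bool
  | .vec | .rev | .dup => Bool × Bool
  | .out => τ ⊕ (Bool × Bool)

/-- The registers: the last letter and the last entry read, the entry to be shifted in, whether the
current list of entries describes a variable, and the sign of the current literal of a clause. -/
structure Register where
  chr : Option (Option Bool) := none
  ent : Option (Bool × Bool) := none
  carry : Bool := true
  isLit : Bool := true
  sign : Bool := false
  deriving Fintype

/-- The entry last read. -/
def Register.entry (r : Register) : Bool × Bool := r.ent.getD (false, false)

/-- The bit last read, if any. -/
def Register.bit? (r : Register) : Option Bool := r.chr.join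

/-- The program. After the description of the last variable has been written down, it is shifted
by one position to obtain that of the preceding one, until the nontrivial entry drops out. Then
`vec` has only trivial entries; in these the literals of each clause are marked. -/
def program : Label → TM2.Stmt (Alphabet τ) Label Register
  | .readCount => pop .inp (fun r a => { r with chr := a }) <|
      branch (fun r => r.bit?.isSome)
        (push .vec (fun r => (r.carry, r.carry)) <| load (fun r => { r with carry := false }) <|
          goto fun _ => .readCount)
        (branch (fun r => r.carry)
          (load (fun r => { r with isLit := false }) (goto fun _ => .clause))
          (push .out (fun _ => .inl (g.lit true)) (goto fun _ => .copy)))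
  | .copy => pop .vec (fun r a => { r with ent := a }) <|
      branch (fun r => r.ent.isSome)
        (push .rev Register.entry <| push .dup Register.entry <| goto fun _ => .copy)
        (goto fun _ => .emit)
  | .emit => pop .rev (fun r a => { r with ent := a }) <|
      branch (fun r => r.ent.isSome)
        (push .out (fun r => .inr r.entry) <|
          push .vec (fun r => (r.isLit && r.carry, r.isLit && r.carry)) <|
          load (fun r => { r with carry := r.entry.1 }) <| goto fun _ => .emit)
        (push .out (fun r => .inl (if r.isLit then g.lit false else g.clause false))
          (goto fun _ => .emitDup))
  | .emitDup => pop .dup (fun r a => { r with ent := a }) <|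
      branch (fun r => r.ent.isSome)
        (push .out (fun r => .inr r.entry) (goto fun _ => .emitDup))
        (branch (fun r => r.isLit && !r.carry)
          (push .out (fun _ => .inl (g.lit true)) (goto fun _ => .copy))
          (load (fun r => { r with isLit := false }) (goto fun _ => .clause)))
  | .clause => pop .inp (fun r a => { r with chr := a }) <|
      branch (fun r => r.chr.isSome)
        (branch (fun r => r.bit?.isSome)
          (load (fun r => { r with sign := r.bit?.getD false }) (goto fun _ => .walk))
          (push .out (fun _ => .inl (g.clause true)) (goto fun _ => .copy)))
        (goto fun _ => .finish)
  | .walk => pop .inp (fun r a => { r with chr := a }) <|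
      branch (fun r => r.bit?.isSome)
        (pop .vec (fun r a => { r with ent := a }) <| push .dup Register.entry <|
          goto fun _ => .walk)
        (pop .vec (fun r a => { r with ent := a }) <| push .vec (fun r => mark r.sign r.entry) <|
          goto fun _ => .back)
  | .back => pop .dup (fun r a => { r with ent := a }) <|
      branch (fun r => r.ent.isSome)
        (push .vec Register.entry (goto fun _ => .back))
        (goto fun _ => .clause)
  | .finish => pop .vec (fun r a => { r with ent := a }) <|
      branch (fun r => r.ent.isSome) (goto fun _ => .finish)
        (pushList .out (g.extra.map .inl) <| load (fun _ => {}) halt)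

/-- The machine that, given a formula, writes its list of descriptors, backwards. -/
def machine : TM2ComputableAux (Option Bool) (τ ⊕ (Bool × Bool)) where
  tm :=
    { K := Stack
      k₀ := .inp
      k₁ := .out
      Γ := Alphabet τ
      Λ := Label
      main := .readCount
      σ := Register
      initialState := {}
      Γk₀Fin := inferInstanceAs (Fintype (Option Bool))
      m := g.program }
  inputAlphabet := .refl _
  outputAlphabet := .refl _

/-- The stacks with the given contents. -/
@[simp]
def stk (inp : List (Option Bool)) (vec rev dup : List (Bool × Bool))
    (out : List (τ ⊕ (Bool × Bool))) : ∀ k, List (Alphabet τ k)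
  | .inp => inp
  | .vec => vec
  | .rev => rev
  | .dup => dup
  | .out => out

section Stack

variable (i : List (Option Bool)) (v r d : List (Bool × Bool)) (o : List (τ ⊕ (Bool × Bool)))

@[simp]
theorem update_stk_inp (x) : Function.update (stk i v r d o) .inp x = stk x v r d o := by
  funext k; cases k <;> rfl

@[simp]
theorem update_stk_vec (x) : Function.update (stk i v r d o) .vec x = stk i x r d o := by
  funext k; cases k <;> rfl

@[simp]
theorem update_stk_rev (x) : Function.update (stk i v r d o) .rev x = stk i v x d o := by
  funext k; cases k <;> rfl

@[simp]
theorem update_stk_dup (x) : Function.update (stk i v r d o) .dup x = stk i v r x o := by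
  funext k; cases k <;> rfl

@[simp]
theorem update_stk_out (x) : Function.update (stk i v r d o) .out x = stk i v r d x := by
  funext k; cases k <;> rfl

theorem update_nil_inp :
    (Function.update (fun _ => []) .inp i : ∀ k, List (Alphabet τ k)) = stk i [] [] [] [] := by
  funext k; cases k <;> rfl

theorem update_nil_out :
    (Function.update (fun _ => []) .out o : ∀ k, List (Alphabet τ k)) = stk [] [] [] [] o := by
  funext k; cases k <;> rfl

end Stack

/-- Bounded reachability between running configurations of the program. -/
abbrev Reach (T : ℕ) (l : Label) (r : Register) (S : ∀ k, List (Alphabet τ k)) (l' : Label)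
    (r' : Register) (S' : ∀ k, List (Alphabet τ k)) : Prop :=
  ReachesWithin (TM2.step g.program) T ⟨some l, r, S⟩ ⟨some l', r', S'⟩

theorem reach_copy (v : List (Bool × Bool)) (i d d' o) (r : Register) :
    g.Reach (v.length + 1) .copy r (stk i v d d' o) .emit { r with ent := none }
      (stk i [] (v.reverse ++ d) (v.reverse ++ d') o) := by
  induction v generalizing d d' r with
  | nil => exact .single (by simp [program])
  | cons x v ih =>
    refine .head ?_ (by simpa using ih (x :: d) (x :: d') { r with ent := some x })
    simp [program, Register.entry]

theorem reach_emit_clause (w : List (Bool × Bool)) (i v d o) (r : Register)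
    (hr : r.isLit = false) :
    ∃ r', r'.isLit = false ∧ g.Reach (w.length + 1) .emit r (stk i v w d o) .emitDup r'
      (stk i (List.replicate w.length (false, false) ++ v) [] d
        (.inl (g.clause false) :: ((w.map .inr).reverse ++ o))) := by
  induction w generalizing v o r with
  | nil => exact ⟨{ r with ent := none }, hr, .single (by simp [program, hr])⟩
  | cons x w ih =>
    obtain ⟨r', hr', rest⟩ := ih ((false, false) :: v) (.inr x :: o)
      { r with ent := some x, carry := x.1 } hr
    refine ⟨r', hr', .head ?_ (by simpa [List.replicate_succ'] using rest)⟩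
    simp [program, hr, Register.entry]

theorem reach_emit_lit (w : List (Bool × Bool)) (x : Bool × Bool) (hw : ∀ y ∈ w, y.2 = y.1)
    (i v d o) (r : Register) (hr : r.isLit = true) :
    g.Reach (w.length + 2) .emit r (stk i v (w ++ [x]) d o) .emitDup
      { r with ent := none, carry := x.1 }
      (stk i (((r.carry, r.carry) :: w).reverse ++ v) [] d
        (.inl (g.lit false) :: (((w ++ [x]).map .inr).reverse ++ o))) := by
  induction w generalizing v o r with
  | nil =>
    refine .head (b := ⟨some .emit, { r with ent := some x, carry := x.1 },
      stk i ((r.carry, r.carry) :: v) [] d (.inr x :: o)⟩) ?_ (.single ?_)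
    all_goals simp [program, hr, Register.entry]
  | cons y w ih =>
    have hy : (y.1, y.1) = y := Prod.ext rfl (hw y List.mem_cons_self).symm
    have rest := ih (fun z hz => hw z (List.mem_cons_of_mem _ hz)) ((r.carry, r.carry) :: v)
      (.inr y :: o) { r with ent := some y, carry := y.1 } hr
    refine .head ?_ (by simpa [hy] using rest)
    simp [program, hr, Register.entry]

theorem reach_emitDup (w : List (Bool × Bool)) (i v d o) (r : Register)
    {c : TM2.Cfg (Alphabet τ) Label Register}
    (hc : TM2.step g.program ⟨some .emitDup, { r with ent := none },
      stk i v d [] ((w.map .inr).reverse ++ o)⟩ = some c) :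
    ReachesWithin (TM2.step g.program) (w.length + 1) ⟨some .emitDup, r, stk i v d w o⟩ c := by
  induction w generalizing o r with
  | nil => exact .single (Eq.trans (by simp [program]) hc)
  | cons x w ih =>
    refine .head (b := ⟨some .emitDup, { r with ent := some x }, stk i v d w (.inr x :: o)⟩)
      ?_ (ih _ _ (Eq.trans ?_ hc))
    · simp [program, Register.entry]
    · simp

theorem reach_emitDup_clause (w : List (Bool × Bool)) (i v d o) (r : Register)
    (hr : r.isLit = false ∨ r.carry = true) :
    g.Reach (w.length + 1) .emitDup r (stk i v d w o) .clause
      { r with ent := none, isLit := false } (stk i v d [] ((w.map .inr).reverse ++ o)) := by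
  refine g.reach_emitDup w i v d o r ?_
  rcases hr with hr | hr <;> simp [program, hr]

theorem reach_emitDup_lit (w : List (Bool × Bool)) (i v d o) (r : Register)
    (hr : r.isLit = true) (hr' : r.carry = false) :
    g.Reach (w.length + 1) .emitDup r (stk i v d w o) .copy { r with ent := none }
      (stk i v d [] (.inl (g.lit true) :: ((w.map .inr).reverse ++ o))) := by
  refine g.reach_emitDup w i v d o r ?_
  simp [program, hr, hr']

theorem reach_variable (w : List (Bool × Bool)) (x : Bool × Bool) (hw : ∀ y ∈ w, y.2 = y.1)
    (i o) (r : Register) (hr : r.isLit = true) :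
    g.Reach (2 * w.length + 4) .copy r
      (stk i (w ++ [x]).reverse [] [] o) .emitDup { r with ent := none, carry := x.1 }
      (stk i ((r.carry, r.carry) :: w).reverse [] (w ++ [x])
        (.inl (g.lit false) :: (((w ++ [x]).map .inr).reverse ++ o))) := by
  have copied := g.reach_copy (w ++ [x]).reverse i [] [] o r
  simp only [List.append_nil, List.reverse_reverse] at copied
  have emitted := g.reach_emit_lit w x hw i [] (w ++ [x]) o { r with ent := none } hr
  simp only [List.append_nil] at emitted
  refine .mono (copied.trans emitted) ?_
  simp only [List.length_reverse, List.length_append, List.length_cons, List.length_nil]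
  omega

theorem reach_variables {N i : ℕ} (hi : i ≤ N) (s o) (r : Register) (hr : r.isLit = true)
    (hc : r.carry = false) :
    ∃ r', r'.isLit = false ∧ g.Reach ((i + 1) * (3 * N + 6)) .copy r
      (stk s (unitVector (N + 1) i).reverse [] [] (.inl (g.lit true) :: o)) .clause r'
      (stk s (List.replicate (N + 1) (false, false)) [] []
        ((tokens ((List.range (i + 1)).reverse.flatMap fun i =>
          twoCopies g.lit (unitVector (N + 1) i))).reverse ++ o)) := by
  induction i generalizing o r with
  | zero =>
    have first := g.reach_variable (List.replicate N (false, false)) (true, true)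
      (by simp) s (.inl (g.lit true) :: o) r hr
    have last := first.trans (g.reach_emitDup_clause _ _ _ _ _ _ (.inr rfl))
    refine ⟨_, rfl, .mono (by
      simpa [unitVector_succ_zero, twoCopies, hc, List.replicate_succ'] using last) ?_⟩
    omega
  | succ i ih =>
    have hw : ∀ y ∈ unitVector N i, y.2 = y.1 := by simp [unitVector]
    have first := (g.reach_variable _ (false, false) hw s (.inl (g.lit true) :: o) r hr).trans
      (g.reach_emitDup_lit _ _ _ _ _ _ hr rfl)
    have shifted : (false, false) :: unitVector N i = unitVector (N + 1) i := by
      simp [unitVector_succ, show N ≠ i by omega]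
    rw [hc, shifted, ← unitVector_succ_succ] at first
    obtain ⟨r', hr', rest⟩ := ih (by omega) (((unitVector (N + 1) (i + 1)).map .inr).reverse ++
      .inl (g.lit false) :: (((unitVector (N + 1) (i + 1)).map .inr).reverse ++
        .inl (g.lit true) :: o)) { r with ent := none, carry := false } hr rfl
    refine ⟨r', hr', .mono (first.trans (by
      simpa [List.range_succ (n := i + 1), twoCopies] using rest)) ?_⟩
    simp only [length_unitVector]
    linarith

theorem reach_readCount (N : ℕ) (i v o) (r : Register) (hc : r.carry = false) :
    g.Reach (N + 1) .readCount r (stk (encodeUnary N ++ i) v [] [] o) .copy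
      { r with chr := some none }
      (stk i (List.replicate N (false, false) ++ v) [] [] (.inl (g.lit true) :: o)) := by
  induction N generalizing v r with
  | zero => exact .single (by simp [program, encodeUnary, Register.bit?, hc])
  | succ N ih =>
    have rest := ih ((false, false) :: v) { r with chr := some (some true), carry := false } rfl
    refine .head (b := ⟨some .readCount, { r with chr := some (some true), carry := false },
      stk (encodeUnary N ++ i) ((false, false) :: v) [] [] o⟩) ?_ ?_
    · simp [program, encodeUnary, Register.bit?, List.replicate_succ, hc]
    · simpa [List.replicate_succ', hc] using rest

theorem reach_allVariables (N : ℕ) (i) :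
    ∃ r', r'.isLit = false ∧ g.Reach (N + 1 + N * (3 * N + 3)) .readCount {}
      (stk (encodeUnary N ++ i) [] [] [] [])
      .clause r' (stk i (List.replicate N (false, false)) [] []
        (tokens ((List.range N).reverse.flatMap fun i =>
          twoCopies g.lit (unitVector N i))).reverse) := by
  cases N with
  | zero =>
    refine ⟨{ chr := some none, isLit := false }, rfl, .mono (.single ?_) le_rfl⟩
    simp [program, encodeUnary, Register.bit?]
  | succ N =>
    have start := g.reach_readCount N i [(true, true)] []
      { chr := some (some true), carry := false } rfl
    have last : List.replicate N (false, false) ++ [(true, true)] =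
        (unitVector (N + 1) N).reverse := by
      simp [unitVector_succ, unitVector_of_le]
    rw [last] at start
    obtain ⟨r', hr', rest⟩ := g.reach_variables le_rfl i []
      { chr := some none, carry := false } rfl rfl
    rw [List.append_nil] at rest
    refine ⟨r', hr', .mono (.head ?_ (start.trans rest)) (by linarith)⟩
    simp [program, encodeUnary, Register.bit?, List.replicate_succ]

theorem reach_back (w : List (Bool × Bool)) (i v d o) (r : Register) :
    g.Reach (w.length + 1) .back r (stk i v d w o) .clause { r with ent := none }
      (stk i (w.reverse ++ v) d [] o) := by
  induction w generalizing v r with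
  | nil => exact .single (by simp [program])
  | cons x w ih =>
    refine .head ?_ (by simpa using ih (x :: v) { r with ent := some x })
    simp [program, Register.entry]

theorem reach_walk (l l' w : List (Bool × Bool)) (x : Bool × Bool) (i o) (r : Register)
    (hr : r.isLit = false) :
    ∃ r', r'.isLit = false ∧ g.Reach (2 * l.length + w.length + 2) .walk r
      (stk (encodeUnary l.length ++ i) (l ++ x :: l') [] w o) .clause r'
      (stk i (w.reverse ++ (l ++ mark r.sign x :: l')) [] [] o) := by
  induction l generalizing w r with
  | nil =>
    have back := g.reach_back w i (mark r.sign x :: l') [] o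
      { r with chr := some none, ent := some x }
    refine ⟨_, ?_, .mono (.head ?_ back) ?_⟩
    · exact hr
    · simp [program, encodeUnary, Register.bit?, Register.entry]
    · simp
  | cons y l ih =>
    obtain ⟨r', hr', rest⟩ := ih (y :: w) { r with chr := some (some true), ent := some y } hr
    refine ⟨r', hr', .mono (.head (b := ⟨some .walk,
      { r with chr := some (some true), ent := some y },
      stk (encodeUnary l.length ++ i) (l ++ x :: l') [] (y :: w) o⟩) ?_ (by simpa using rest)) ?_⟩
    · simp [program, encodeUnary, Register.bit?, Register.entry, List.replicate_succ]
    · simp only [List.length_cons]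
      omega

theorem reach_literal (l : Fin N × Bool) (f : Fin N → Bool × Bool) (i o) (r : Register)
    (hr : r.isLit = false) :
    ∃ r', r'.isLit = false ∧ g.Reach (2 * (some l.2 :: encodeUnary l.1).length) .clause r
      (stk (some l.2 :: encodeUnary l.1 ++ i) ((List.finRange N).map f) [] [] o) .clause r'
      (stk i ((List.finRange N).map (record [l] f)) [] [] o) := by
  obtain ⟨k, b⟩ := l
  have hk : (k : ℕ) < ((List.finRange N).map f).length := by simp
  obtain ⟨r', hr', walked⟩ := g.reach_walk (((List.finRange N).map f).take k)
    (((List.finRange N).map f).drop (k + 1)) [] ((List.finRange N).map f)[(k : ℕ)] i o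
    { r with chr := some (some b), sign := b } hr
  rw [List.length_take_of_le hk.le, List.getElem_cons_drop, List.take_append_drop,
    List.reverse_nil, List.nil_append, ← List.modify_eq_take_cons_drop,
    modify_map_finRange (k, b)] at walked
  refine ⟨r', hr', .mono (.head ?_ walked) ?_⟩
  · simp [program, Register.bit?]
  · simp only [encodeUnary, List.length_cons, List.length_append, List.length_replicate,
      List.length_nil]
    omega

/-- The literals of a clause as they appear in the encoding of a formula. -/
def encodeLiterals (c : List (Fin N × Bool)) : List (Option Bool) :=
  c.flatMap fun l => some l.2 :: encodeUnary l.1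

theorem reach_literals (c : List (Fin N × Bool)) (f : Fin N → Bool × Bool) (i o) (r : Register)
    (hr : r.isLit = false) :
    ∃ r', r'.isLit = false ∧ g.Reach (2 * (encodeLiterals c).length) .clause r
      (stk (encodeLiterals c ++ i) ((List.finRange N).map f) [] [] o) .clause r'
      (stk i ((List.finRange N).map (record c f)) [] [] o) := by
  induction c generalizing f r with
  | nil => exact ⟨r, hr, by rw [record_nil]; exact .refl _ _⟩
  | cons l c ih =>
    obtain ⟨r₁, hr₁, first⟩ := g.reach_literal l f (encodeLiterals c ++ i) o r hr
    obtain ⟨r₂, hr₂, rest⟩ := ih (record [l] f) r₁ hr₁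
    have literals_cons : encodeLiterals (l :: c) =
        some l.2 :: encodeUnary l.1 ++ encodeLiterals c := List.flatMap_cons
    rw [← record_cons] at rest
    rw [literals_cons, List.append_assoc, List.length_append, mul_add]
    exact ⟨r₂, hr₂, first.trans rest⟩

theorem reach_clause (c : List (Fin N × Bool)) (i o) (r : Register) (hr : r.isLit = false) :
    ∃ r', r'.isLit = false ∧ g.Reach (2 * (encodeLiterals c).length + 3 * N + 4) .clause r
      (stk (encodeLiterals c ++ none :: i) (List.replicate N (false, false)) [] [] o) .clause r'
      (stk i (List.replicate N (false, false)) [] []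
        ((tokens (twoCopies g.clause (clauseVector c))).reverse ++ o)) := by
  obtain ⟨r₁, hr₁, read⟩ := g.reach_literals c (fun _ => (false, false)) (none :: i) o r hr
  rw [List.map_const', List.length_finRange] at read
  have copied := g.reach_copy ((List.finRange N).map (record c fun _ => (false, false))) i [] []
    (.inl (g.clause true) :: o) { r₁ with chr := some none }
  rw [← List.map_reverse, ← clauseVector, List.append_nil] at copied
  obtain ⟨r₂, hr₂, emitted⟩ := g.reach_emit_clause (clauseVector c) i [] (clauseVector c)
    (.inl (g.clause true) :: o) { r₁ with chr := some none, ent := none } hr₁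
  have written := (copied.trans emitted).trans (g.reach_emitDup_clause _ _ _ _ _ _ (.inl hr₂))
  have run := read.trans (.head (by simp [program, Register.bit?]) written)
  refine ⟨_, rfl, .mono (by simpa [twoCopies] using run) ?_⟩
  omega

theorem reach_clauses (cs : List (List (Fin N × Bool))) (o) (r : Register)
    (hr : r.isLit = false) :
    ∃ r', g.Reach (2 * (cs.flatMap fun c => encodeLiterals c ++ [none]).length +
        cs.length * (3 * N + 4) + 1) .clause r
      (stk (cs.flatMap fun c => encodeLiterals c ++ [none]) (List.replicate N (false, false))
        [] [] o)
      .finish r' (stk [] (List.replicate N (false, false)) [] []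
        ((tokens (cs.flatMap fun c => twoCopies g.clause (clauseVector c))).reverse ++ o)) := by
  induction cs generalizing o r with
  | nil => exact ⟨{ r with chr := none }, .mono (.single (by simp [program])) (by simp)⟩
  | cons c cs ih =>
    obtain ⟨r₁, hr₁, first⟩ := g.reach_clause c
      (cs.flatMap fun c => encodeLiterals c ++ [none]) o r hr
    obtain ⟨r₂, rest⟩ := ih ((tokens (twoCopies g.clause (clauseVector c))).reverse ++ o) r₁ hr₁
    have run := first.trans rest
    rw [List.append_cons, ← List.append_assoc, ← List.reverse_append, ← tokens_append] at run
    refine ⟨r₂, .mono run ?_⟩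
    simp only [List.flatMap_cons, List.length_append, List.length_cons, List.length_nil]
    linarith

theorem reachesWithin_finish (v : List (Bool × Bool)) (o) (r : Register) :
    ReachesWithin (TM2.step g.program) (v.length + 1) ⟨some .finish, r, stk [] v [] [] o⟩
      ⟨none, {}, stk [] [] [] [] ((tokens (g.extra.map fun x => ⟨x, []⟩)).reverse ++ o)⟩ := by
  have tokens_extra : tokens (g.extra.map fun x => ⟨x, ([] : List (Bool × Bool))⟩) =
      g.extra.map .inl := by
    simp only [tokens, List.flatMap_map, List.map_nil]
    exact List.map_eq_flatMap.symm
  induction v generalizing r with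
  | nil => exact .single (by simp [program, tokens_extra])
  | cons x v ih => exact .head (by simp [program]) (ih { r with ent := some x })

theorem outputsWithin_tokens_descriptors (F : CNFFormula) :
    OutputsWithin g.machine (3 * F.numVars * F.numVars + 5 * F.numVars + 2 * F.encode.length +
        F.clauses.length * (3 * F.numVars + 4) + 3) F.encode
      (tokens (g.descriptors F)).reverse := by
  obtain ⟨r₁, hr₁, literals⟩ := g.reach_allVariables F.numVars
    (F.clauses.flatMap fun c => encodeLiterals c ++ [none])
  obtain ⟨r₂, clauses⟩ := g.reach_clauses F.clauses _ r₁ hr₁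
  have run := (literals.trans clauses).trans (g.reachesWithin_finish _ _ r₂)
  have inp_eq : F.encode.map g.machine.inputAlphabet.symm =
    encodeUnary F.numVars ++ F.clauses.flatMap fun c => encodeLiterals c ++ [none] := List.map_id _
  have out_eq : (tokens (g.descriptors F)).reverse.map g.machine.outputAlphabet.symm =
    (tokens (g.descriptors F)).reverse := List.map_id _
  rw [outputsWithin_iff_reachesWithin, inp_eq, out_eq]
  rw [← List.reverse_append, ← List.reverse_append, ← tokens_append, ← tokens_append,
    ← update_nil_inp, ← update_nil_out] at run
  refine ReachesWithin.mono run ?_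
  have hlength : (F.clauses.flatMap fun c => encodeLiterals c ++ [none]).length ≤
      F.encode.length := by
    simp [CNFFormula.encode, encodeLiterals]
  rw [List.length_replicate]
  linarith

end FormulaTags

/-! ### Common neighbours and 2-clubs -/

section CommonNeighbors

variable {V W : Type*}

/-- `u` and `v` have at least `q` common neighbours within `S`. -/
def HasCommonNeighbors (G : SimpleGraph V) (S : Set V) (q : ℕ) (u v : V) : Prop :=
  q ≤ (S ∩ G.commonNeighbors u v).encard

/-- Any two vertices of `S` are adjacent with `q` common neighbours within `S`, or have `q + 1`
common neighbours within `S`. This suffices for a `(q + 1)`-robust or `q`-hereditary 2-club. -/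
def IsTightlyLinked (G : SimpleGraph V) (S : Set V) (q : ℕ) : Prop :=
  ∀ u ∈ S, ∀ v ∈ S, u ≠ v →
    (G.Adj u v ∧ HasCommonNeighbors G S q u v) ∨ HasCommonNeighbors G S (q + 1) u v

/-- Any two non-adjacent vertices of `S` have `q + 1` common neighbours within `S`. This is
necessary for a `(q + 1)`-robust or `q`-hereditary 2-club. -/
def IsLooselyLinked (G : SimpleGraph V) (S : Set V) (q : ℕ) : Prop :=
  ∀ u ∈ S, ∀ v ∈ S, u ≠ v → ¬ G.Adj u v → HasCommonNeighbors G S (q + 1) u v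

variable {G : SimpleGraph V} {S : Set V} {q : ℕ} {u v : V}

theorem HasCommonNeighbors.symm (h : HasCommonNeighbors G S q u v) :
    HasCommonNeighbors G S q v u := by
  rwa [HasCommonNeighbors, SimpleGraph.commonNeighbors_symm]

theorem HasCommonNeighbors.mono {r : ℕ} (h : HasCommonNeighbors G S q u v) (hrq : r ≤ q) :
    HasCommonNeighbors G S r u v :=
  le_trans (mod_cast hrq) h

theorem hasCommonNeighbors_one :
    HasCommonNeighbors G S 1 u v ↔ ∃ w ∈ S, G.Adj u w ∧ G.Adj v w := by
  rw [HasCommonNeighbors, Nat.cast_one, Set.one_le_encard_iff_nonempty]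
  rfl

theorem HasCommonNeighbors.sdiff (A : Finset V) (h : HasCommonNeighbors G S (A.card + q) u v) :
    HasCommonNeighbors G (S \ A) q u v := by
  have step : (A.card + q : ℕ∞) ≤ A.card + ((S ∩ G.commonNeighbors u v) \ A).encard := by
    rw [add_comm (A.card : ℕ∞) (Set.encard _), ← Set.encard_coe_eq_coe_finsetCard]
    refine le_trans ?_ (Set.encard_le_encard_sdiff_add_encard _ _)
    rw [Set.encard_coe_eq_coe_finsetCard]
    exact mod_cast h
  rw [ENat.add_le_add_iff_left (ENat.natCast_ne_top _)] at step
  rwa [HasCommonNeighbors, Set.inter_comm, ← Set.inter_sdiff_assoc, Set.inter_comm]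

theorem HasCommonNeighbors.exists_embedding (h : HasCommonNeighbors G S q u v) :
    ∃ f : Fin q ↪ V, ∀ i, f i ∈ S ∧ G.Adj u (f i) ∧ G.Adj v (f i) := by
  obtain ⟨T, hT, hq⟩ := Set.exists_subset_encard_eq h
  obtain ⟨T, rfl⟩ := (Set.finite_of_encard_eq_coe hq).exists_finset_coe
  rw [Set.encard_coe_eq_coe_finsetCard, Nat.cast_inj] at hq
  exact ⟨(T.equivFinOfCardEq hq).symm.toEmbedding.trans (.subtype _),
    fun i => hT ((T.equivFinOfCardEq hq).symm i).2⟩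

theorem isLooselyLinked_zero :
    IsLooselyLinked G S 0 ↔ ∀ u ∈ S, ∀ v ∈ S, u ≠ v → ¬ G.Adj u v →
      ∃ w ∈ S, G.Adj u w ∧ G.Adj v w := by
  simp only [IsLooselyLinked, Nat.zero_add, hasCommonNeighbors_one]

section Comap

variable (e : V ≃ W) {H : SimpleGraph W} {T : Set W}

theorem hasCommonNeighbors_comap :
    HasCommonNeighbors (H.comap e) (e ⁻¹' T) q u v ↔ HasCommonNeighbors H T q (e u) (e v) := by
  have preimage : e ⁻¹' T ∩ (H.comap e).commonNeighbors u v =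
      e ⁻¹' (T ∩ H.commonNeighbors (e u) (e v)) := rfl
  rw [HasCommonNeighbors, HasCommonNeighbors, preimage,
    Set.encard_preimage_of_bijective e.bijective]

theorem isTightlyLinked_comap :
    IsTightlyLinked (H.comap e) (e ⁻¹' T) q ↔ IsTightlyLinked H T q := by
  simp only [IsTightlyLinked, hasCommonNeighbors_comap, e.forall_congr_left, Set.mem_preimage,
    SimpleGraph.comap_adj, Equiv.apply_symm_apply, ne_eq, EmbeddingLike.apply_eq_iff_eq]

theorem isLooselyLinked_comap :
    IsLooselyLinked (H.comap e) (e ⁻¹' T) q ↔ IsLooselyLinked H T q := by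
  simp only [IsLooselyLinked, hasCommonNeighbors_comap, e.forall_congr_left, Set.mem_preimage,
    SimpleGraph.comap_adj, Equiv.apply_symm_apply, ne_eq, EmbeddingLike.apply_eq_iff_eq]

end Comap

section Universal

variable {A : Finset V}

theorem HasCommonNeighbors.of_sdiff (hAS : ↑A ⊆ S) (hu : ∀ x ∈ A, G.Adj x u)
    (hv : ∀ x ∈ A, G.Adj x v) (h : HasCommonNeighbors G (S \ A) q u v) :
    HasCommonNeighbors G S (A.card + q) u v := by
  have disjoint : Disjoint (A : Set V) ((S \ A) ∩ G.commonNeighbors u v) :=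
    Set.disjoint_sdiff_right.mono_right Set.inter_subset_left
  calc ((A.card + q : ℕ) : ℕ∞)
      ≤ (A : Set V).encard + ((S \ A) ∩ G.commonNeighbors u v).encard := by
        rw [Set.encard_coe_eq_coe_finsetCard, Nat.cast_add]
        exact add_le_add_right h _
    _ = (↑A ∪ ((S \ A) ∩ G.commonNeighbors u v)).encard := (Set.encard_union_eq disjoint).symm
    _ ≤ (S ∩ G.commonNeighbors u v).encard := Set.encard_le_encard (Set.union_subset
        (fun x hx => ⟨hAS hx, (hu x hx).symm, (hv x hx).symm⟩)
        (Set.inter_subset_inter_left _ Set.sdiff_subset))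

theorem hasCommonNeighbors_of_universal (hu : ∀ w, w ≠ u → G.Adj u w)
    (h : q + 1 ≤ (S ∩ G.neighborSet v).encard) : HasCommonNeighbors G S q u v := by
  have step := h.trans (Set.encard_le_encard_sdiff_add_encard _ {u})
  rw [Set.encard_singleton, ENat.add_le_add_iff_right ENat.one_ne_top] at step
  refine step.trans (Set.encard_le_encard ?_)
  exact fun w hw => ⟨hw.1.1, hu w hw.2, hw.1.2⟩

theorem card_universal_lt_encard_neighborSet (hA : ∀ x ∈ A, ∀ v, v ≠ x → G.Adj x v)
    (hAS : ↑A ⊆ S) (hnontrivial : (S \ A).Nontrivial) (h : IsLooselyLinked G (S \ A) 0)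
    (hv : v ∈ S) : A.card + 1 ≤ (S ∩ G.neighborSet v).encard := by
  by_cases hvA : v ∈ A
  · have two_le : (1 + 1 : ℕ∞) ≤ (S \ A).encard :=
      Order.add_one_le_of_lt (Set.one_lt_encard_iff_nontrivial.2 hnontrivial)
    have step : (A.card + 1 + 1 : ℕ∞) ≤ (S \ {v}).encard + 1 :=
      calc (A.card + 1 + 1 : ℕ∞) ≤ A.card + (S \ A).encard := by rw [add_assoc]; gcongr
        _ = S.encard := by
          rw [← Set.encard_coe_eq_coe_finsetCard, add_comm,
            Set.encard_sdiff_add_encard_of_subset hAS]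
        _ = _ := (Set.encard_sdiff_singleton_add_one hv).symm
    rw [ENat.add_le_add_iff_right ENat.one_ne_top] at step
    refine step.trans (Set.encard_le_encard ?_)
    exact fun w hw => ⟨hw.1, hA v hvA w hw.2⟩
  · obtain ⟨w, ⟨hwS, hwA⟩, hvw⟩ : ∃ w ∈ S \ ↑A, G.Adj v w := by
      obtain ⟨w, hw, hwv⟩ := hnontrivial.exists_ne v
      by_cases hvw : G.Adj v w
      · exact ⟨w, hw, hvw⟩
      · obtain ⟨x, hx, hvx, -⟩ := isLooselyLinked_zero.1 h v ⟨hv, hvA⟩ w hw hwv.symm hvw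
        exact ⟨x, hx, hvx⟩
    rw [← Set.encard_coe_eq_coe_finsetCard, ← Set.encard_insert_of_notMem hwA]
    exact Set.encard_le_encard (Set.insert_subset ⟨hwS, hvw⟩ fun x hx =>
      ⟨hAS hx, (hA x hx v (ne_of_mem_of_not_mem hx hvA).symm).symm⟩)

theorem IsLooselyLinked.isTightlyLinked_of_universal (hA : ∀ x ∈ A, ∀ v, v ≠ x → G.Adj x v)
    (hAS : ↑A ⊆ S) (hnontrivial : (S \ A).Nontrivial) (h : IsLooselyLinked G (S \ A) 0) :
    IsTightlyLinked G S A.card := by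
  intro u hu v hv huv
  have few : ∀ {x y}, x ∈ A → y ∈ S → HasCommonNeighbors G S A.card x y := fun hx hy =>
    hasCommonNeighbors_of_universal (hA _ hx)
      (card_universal_lt_encard_neighborSet hA hAS hnontrivial h hy)
  by_cases huA : u ∈ A
  · exact .inl ⟨hA u huA v huv.symm, few huA hv⟩
  by_cases hvA : v ∈ A
  · exact .inl ⟨(hA v hvA u huv).symm, (few hvA hu).symm⟩
  have adj : ∀ {y}, y ∉ A → ∀ x ∈ A, G.Adj x y := fun hy x hx =>
    hA x hx _ (ne_of_mem_of_not_mem hx hy).symm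
  by_cases huv' : G.Adj u v
  · exact .inl ⟨huv', .of_sdiff (q := 0) hAS (adj huA) (adj hvA) (by simp [HasCommonNeighbors])⟩
  · exact .inr (.of_sdiff hAS (adj huA) (adj hvA) (h u ⟨hu, huA⟩ v ⟨hv, hvA⟩ huv huv'))

end Universal

theorem IsLooselyLinked.sdiff (A : Finset V) (h : IsLooselyLinked G S (A.card + q)) :
    IsLooselyLinked G (S \ A) q :=
  fun u hu v hv huv hadj => .sdiff A (h u hu.1 v hv.1 huv hadj)

end CommonNeighbors

section Clubs

variable {V : Type} {G : SimpleGraph V} {S : Set V} {u v : V}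

theorem exists_middle_of_walk (p : G.Walk u v) (hp : p.length ≤ 2) (huv : u ≠ v)
    (hadj : ¬ G.Adj u v) : ∃ w ∈ p.support, G.Adj u w ∧ G.Adj w v := by
  match p, hp with
  | .nil, _ => exact absurd rfl huv
  | .cons h .nil, _ => exact absurd h hadj
  | .cons h (.cons h' .nil), _ => exact ⟨_, by simp, h, h'⟩
  | .cons _ (.cons _ (.cons _ _)), hp => simp at hp

/-- `m` is what may lie between `u` and `v` on a path of length at most two: nothing if they are
adjacent, or else a common neighbour. -/
def IsMiddle (G : SimpleGraph V) (u v : V) : Option V → Prop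
  | none => G.Adj u v
  | some w => G.Adj u w ∧ G.Adj v w

theorem IsMiddle.exists_path {m : Option V} (hm : IsMiddle G u v m) (huv : u ≠ v) :
    ∃ P : G.Path u v, (P : G.Walk u v).length ≤ 2 ∧
      ∀ x, x ≠ u → x ≠ v → (x ∈ (P : G.Walk u v).support ↔ m = some x) := by
  match m, hm with
  | none, hm =>
    have hadj : G.Adj u v := hm
    refine ⟨.singleton hadj, by simp [SimpleGraph.Path.singleton], fun x hxu hxv => ?_⟩
    simp [SimpleGraph.Path.singleton, hxu, hxv]
  | some w, ⟨huw, hvw⟩ =>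
    refine ⟨⟨.cons huw (.cons hvw.symm .nil), ?_⟩, by simp, fun x hxu hxv => ?_⟩
    · simp [SimpleGraph.Walk.cons_isPath_iff, huw.ne, hvw.ne.symm, huv]
    · simp [hxu, hxv, eq_comm]

theorem exists_disjoint_paths_of_middles {ι : Type*} (m : ι → Option V) (hinj : m.Injective)
    (hm : ∀ i, IsMiddle G u v (m i)) (huv : u ≠ v) :
    ∃ P : ι → G.Path u v, P.Injective ∧ (∀ i, (P i : G.Walk u v).length ≤ 2) ∧
      ∀ i j, i ≠ j → ∀ w, w ∈ (P i : G.Walk u v).support → w ∈ (P j : G.Walk u v).support →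
        w = u ∨ w = v := by
  choose P hlen hsupp using fun i => (hm i).exists_path huv
  have ne_ends : ∀ i x, m i = some x → x ≠ u ∧ x ≠ v := fun i x hx => by
    have hx' := hx ▸ hm i
    exact ⟨hx'.1.ne', hx'.2.ne'⟩
  refine ⟨P, fun i j hij => hinj (Option.ext fun x => ?_), hlen, fun i j hij w hi hj => ?_⟩
  · constructor <;> intro hx
    · obtain ⟨hxu, hxv⟩ := ne_ends i x hx
      rwa [← hsupp j x hxu hxv, ← hij, hsupp i x hxu hxv]
    · obtain ⟨hxu, hxv⟩ := ne_ends j x hx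
      rwa [← hsupp i x hxu hxv, hij, hsupp j x hxu hxv]
  · by_contra! hw
    rw [hsupp i w hw.1 hw.2] at hi
    rw [hsupp j w hw.1 hw.2] at hj
    exact hij (hinj (hi.trans hj.symm))

theorem IsTightlyLinked.isRobustTwoClub {q : ℕ} (h : IsTightlyLinked G S q) :
    IsRobustTwoClub (q + 1) G S := by
  rintro ⟨u, hu⟩ ⟨v, hv⟩ huv
  rcases h u hu v hv (fun h => huv (Subtype.ext h)) with ⟨hadj, hcommon⟩ | hcommon
  · obtain ⟨f, hf⟩ := hcommon.exists_embedding
    refine exists_disjoint_paths_of_middles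
      (Fin.cons none fun i => some ⟨f i, (hf i).1⟩) ?_ (Fin.cases hadj fun i => (hf i).2) huv
    rw [Fin.cons_injective_iff]
    exact ⟨by simp, fun i j hij => f.injective (by simpa using hij)⟩
  · obtain ⟨f, hf⟩ := hcommon.exists_embedding
    exact exists_disjoint_paths_of_middles (fun i => some ⟨f i, (hf i).1⟩)
      (fun i j hij => f.injective (by simpa using hij)) (fun i => (hf i).2) huv

theorem IsRobustTwoClub.isLooselyLinked {q : ℕ} (h : IsRobustTwoClub (q + 1) G S) :
    IsLooselyLinked G S q := by
  intro u hu v hv huv hadj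
  have huv' : (⟨u, hu⟩ : S) ≠ ⟨v, hv⟩ := fun h => huv (congrArg Subtype.val h)
  obtain ⟨P, -, hlen, hdisj⟩ := h ⟨u, hu⟩ ⟨v, hv⟩ huv'
  choose w hw huw hwv using fun i => exists_middle_of_walk (P i).1 (hlen i) huv' hadj
  have hinj : Function.Injective fun i => (w i : V) := fun i j hij => by
    by_contra hne
    rcases hdisj i j hne (w i) (hw i) (Subtype.ext hij ▸ hw j) with h | h
    · exact (huw i).ne h.symm
    · exact (hwv i).ne h
  calc ((q + 1 : ℕ) : ℕ∞) = ENat.card (Fin (q + 1)) := by simp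
    _ ≤ (Set.range fun i => (w i : V)).encard := hinj.encard_range
    _ ≤ (S ∩ G.commonNeighbors u v).encard := Set.encard_le_encard <| Set.range_subset_iff.2
        fun i => ⟨(w i).2, huw i, (hwv i).symm⟩

theorem IsTightlyLinked.isHereditaryTwoClub {q : ℕ} (h : IsTightlyLinked G S q) :
    IsHereditaryTwoClub q G S := by
  intro U _ hUq
  refine SimpleGraph.ediam_le_of_edist_le ?_
  rintro ⟨u, hu, huU⟩ ⟨v, hv, hvU⟩
  by_cases huv : u = v
  · subst huv
    simp
  rcases h u hu v hv huv with ⟨hadj, -⟩ | hcommon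
  · have hadj' : (G.induce (S \ U)).Adj ⟨u, hu, huU⟩ ⟨v, hv, hvU⟩ := hadj
    exact hadj'.toWalk.edist_le.trans (by simp)
  · obtain ⟨w, hw, huw, hvw⟩ : ∃ w ∈ S \ ↑U, G.Adj u w ∧ G.Adj v w := by
      rw [← hasCommonNeighbors_one]
      exact (hcommon.mono (by omega)).sdiff U
    have huw' : (G.induce (S \ U)).Adj ⟨u, hu, huU⟩ ⟨w, hw⟩ := huw
    have hwv' : (G.induce (S \ U)).Adj ⟨w, hw⟩ ⟨v, hv, hvU⟩ := hvw.symm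
    exact (SimpleGraph.Walk.cons huw' hwv'.toWalk).edist_le

theorem IsHereditaryTwoClub.isLooselyLinked {q : ℕ} (h : IsHereditaryTwoClub q G S) :
    IsLooselyLinked G S q := by
  intro u hu v hv huv hadj
  by_contra hfew
  obtain ⟨hfinite, hcard⟩ : (S ∩ G.commonNeighbors u v).Finite ∧
      (S ∩ G.commonNeighbors u v).ncard ≤ q := by
    rw [← Set.encard_le_coe_iff_finite_ncard_le]
    rw [HasCommonNeighbors, Nat.cast_add, Nat.cast_one, not_le] at hfew
    exact Order.le_of_lt_add_one hfew
  obtain ⟨C, hC⟩ := hfinite.exists_finset_coe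
  have mem_C : ∀ {w}, w ∈ C ↔ w ∈ S ∧ G.Adj u w ∧ G.Adj v w := fun {w} => Set.ext_iff.1 hC w
  have huC : u ∉ C := fun hw => (mem_C.1 hw).2.1.ne rfl
  have hvC : v ∉ C := fun hw => (mem_C.1 hw).2.2.ne rfl
  have hdist : (G.induce (S \ C)).edist ⟨u, hu, huC⟩ ⟨v, hv, hvC⟩ ≤ 2 :=
    SimpleGraph.edist_le_ediam.trans
      (h C (fun w hw => (mem_C.1 hw).1) (by rwa [← hC, Set.ncard_coe_finset] at hcard))
  obtain ⟨p, hp⟩ := SimpleGraph.exists_walk_of_edist_ne_top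
    (ne_top_of_le_ne_top (by simp) hdist)
  obtain ⟨w, -, huw, hwv⟩ := exists_middle_of_walk p (by rw [← hp] at hdist; exact_mod_cast hdist)
    (fun h => huv (congrArg Subtype.val h)) hadj
  exact w.2.2 (mem_C.2 ⟨w.2.1, huw, hwv.symm⟩)

end Clubs

/-! ### The graph of a clause system -/

/-- The vertices of the graph of a system of clauses indexed by `κ` over variables indexed by `ι`:
the literals, two copies of each clause, four hubs and `q` apexes. -/
inductive ClubVertex (ι κ : Type*) (q : ℕ)
  | lit (i : ι) (b : Bool)
  | clause (j : κ) (s : Bool)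
  | hub (x y : Bool)
  | apex (k : Fin q)
  deriving DecidableEq, Fintype

/-- The clause `c` contains a pair of opposite literals. -/
def IsTautology {ι : Type*} (c : Set (ι × Bool)) : Prop :=
  ∃ i, (i, true) ∈ c ∧ (i, false) ∈ c

/-- The assignment `a` satisfies each clause of the system `C`. -/
def Satisfies {ι κ : Type*} (C : κ → Set (ι × Bool)) (a : ι → Bool) : Prop :=
  ∀ j, ∃ l ∈ C j, a l.1 = l.2

namespace ClubVertex

variable {ι κ : Type*} {q : ℕ} (C : κ → Set (ι × Bool))

/-- Adjacency in the graph of a clause system. The two copies of a clause have a common neighbour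
among the literals exactly for the literals of the clause; hubs provide common neighbours for every
other non-adjacent pair except opposite literals. -/
def Adj : ClubVertex ι κ q → ClubVertex ι κ q → Prop
  | lit i b, lit i' b' => b ≠ b' ∧ i ≠ i'
  | lit i b, clause j _ | clause j _, lit i b => (i, b) ∈ C j ∧ (i, !b) ∉ C j
  | clause j s, clause j' s' => s ≠ s' ∧ (C j = C j' → IsTautology (C j))
  | lit _ b, hub x _ | hub x _, lit _ b => x = b
  | clause _ s, hub _ y | hub _ y, clause _ s => y = s
  | hub x y, hub x' y' => (x, y) ≠ (x', y')
  | apex k, apex k' => k ≠ k'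
  | apex _, _ | _, apex _ => True

/-- The graph of a clause system. -/
def graph : SimpleGraph (ClubVertex ι κ q) where
  Adj := Adj C
  symm := ⟨fun u v h => by
    cases u <;> cases v <;>
      first
      | exact h
      | exact ⟨h.1.symm, h.2.symm⟩
      | exact Ne.symm h
      | exact ⟨h.1.symm, fun hC => hC ▸ h.2 hC.symm⟩⟩
  loopless := ⟨fun u h => by cases u <;> simp [Adj] at h⟩

variable {C} {S : Set (ClubVertex ι κ q)} {a : ι → Bool}

theorem adj_apex (k : Fin q) (v : ClubVertex ι κ q) (hv : v ≠ apex k) :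
    (graph C).Adj (apex k) v := by
  cases v with
  | apex k' => exact fun h => hv (by rw [h])
  | _ => trivial

theorem reachable_hub (v : ClubVertex ι κ q) :
    (graph C).Reachable v (hub true true) := by
  have hub_reachable : ∀ x y, (graph C).Reachable (hub x y : ClubVertex ι κ q) (hub true true) := by
    intro x y
    by_cases h : (x, y) = (true, true)
    · obtain ⟨rfl, rfl⟩ := Prod.mk.inj h
      rfl
    · exact SimpleGraph.Adj.reachable (G := graph C) h
  have of_adj : ∀ {x y}, (graph C).Adj v (hub x y) → (graph C).Reachable v (hub true true) :=
    fun h => h.reachable.trans (hub_reachable _ _)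
  cases v with
  | lit i b => exact of_adj (x := b) (y := true) rfl
  | clause j s => exact of_adj (x := true) (y := s) rfl
  | hub x y => exact hub_reachable x y
  | apex k => exact of_adj (x := true) (y := true) trivial

theorem graph_connected : (graph C : SimpleGraph (ClubVertex ι κ q)).Connected :=
  have : Nonempty (ClubVertex ι κ q) := ⟨hub true true⟩
  ⟨fun u v => (reachable_hub u).trans (reachable_hub v).symm⟩

variable (ι κ q) in
/-- The set of apexes. -/
def apexes : Finset (ClubVertex ι κ q) :=
  Finset.univ.map ⟨apex, fun _ _ h => apex.inj h⟩

theorem card_apexes : (apexes ι κ q).card = q := by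
  simp [apexes]

theorem mem_apexes {v : ClubVertex ι κ q} : v ∈ apexes ι κ q ↔ ∃ k, apex k = v := by
  simp only [apexes, Finset.mem_map, Finset.mem_univ, true_and]
  rfl

/-- The vertices other than the literals that the assignment `a` makes false. -/
def kept (a : ι → Bool) : Set (ClubVertex ι κ q) :=
  (Set.range fun i => lit i (!a i))ᶜ

theorem lit_mem_kept {i : ι} {b : Bool} : (lit i b : ClubVertex ι κ q) ∈ kept a ↔ a i = b := by
  simp [kept]

theorem lit_mem_kept_sdiff_apexes {i : ι} {b : Bool} :
    (lit i b : ClubVertex ι κ q) ∈ kept a \ apexes ι κ q ↔ a i = b := by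
  simp [lit_mem_kept, mem_apexes]

theorem clause_mem_kept_sdiff_apexes (j : κ) (s : Bool) :
    (clause j s : ClubVertex ι κ q) ∈ kept a \ apexes ι κ q := by
  simp [kept, mem_apexes]

theorem hub_mem_kept_sdiff_apexes (x y : Bool) :
    (hub x y : ClubVertex ι κ q) ∈ kept a \ apexes ι κ q := by
  simp [kept, mem_apexes]

theorem exists_common_lit (ha : Satisfies C a) {j j' : κ} {s s' : Bool} (hs : s ≠ s')
    (hadj : ¬ (graph C).Adj (clause j s : ClubVertex ι κ q) (clause j' s')) :
    ∃ w ∈ kept a \ apexes ι κ q, (graph C).Adj (clause j s : ClubVertex ι κ q) w ∧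
      (graph C).Adj (clause j' s') w := by
  obtain ⟨hC, htaut⟩ : C j = C j' ∧ ¬ IsTautology (C j) := by
    simpa [graph, Adj, hs] using hadj
  obtain ⟨⟨i, b⟩, hl, hal⟩ := ha j
  have hopposite : (i, !b) ∉ C j := fun h => htaut <| by
    cases b
    · exact ⟨i, h, hl⟩
    · exact ⟨i, hl, h⟩
  have hlit : (i, b) ∈ C j' ∧ (i, !b) ∉ C j' := hC ▸ ⟨hl, hopposite⟩
  exact ⟨lit i b, lit_mem_kept_sdiff_apexes.2 hal, ⟨hl, hopposite⟩, hlit⟩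

theorem isLooselyLinked_kept_sdiff_apexes (ha : Satisfies C a) :
    IsLooselyLinked (graph C : SimpleGraph (ClubVertex ι κ q)) (kept a \ apexes ι κ q) 0 := by
  rw [isLooselyLinked_zero]
  intro u hu v hv huv hadj
  have of_hub : ∀ x y, (graph C).Adj u (hub x y) → (graph C).Adj v (hub x y) →
      ∃ w ∈ kept a \ apexes ι κ q, (graph C).Adj u w ∧ (graph C).Adj v w := fun x y h h' =>
    ⟨hub x y, hub_mem_kept_sdiff_apexes x y, h, h'⟩
  cases u with
  | lit i b =>
    cases v with
    | lit i' b' =>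
      by_cases hb : b = b'
      · exact of_hub b b rfl hb
      · refine absurd ⟨hb, ?_⟩ hadj
        rintro rfl
        exact hb ((lit_mem_kept.1 hu.1).symm.trans (lit_mem_kept.1 hv.1))
    | clause j s => exact of_hub b s rfl rfl
    | hub x y => exact of_hub b (!y) rfl (by simp [graph, Adj])
    | apex k => exact absurd (mem_apexes.2 ⟨k, rfl⟩) hv.2
  | clause j s =>
    cases v with
    | lit i b => exact of_hub b s rfl rfl
    | clause j' s' =>
      by_cases hs : s = s'
      · exact of_hub s s rfl hs
      · exact exists_common_lit ha hs hadj
    | hub x y => exact of_hub (!x) s rfl (by simp [graph, Adj])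
    | apex k => exact absurd (mem_apexes.2 ⟨k, rfl⟩) hv.2
  | hub x y =>
    cases v with
    | lit i b => exact of_hub b (!y) (by simp [graph, Adj]) rfl
    | clause j s => exact of_hub (!x) s (by simp [graph, Adj]) rfl
    | hub x' y' => exact absurd (fun h => huv (by rw [(Prod.mk.inj h).1, (Prod.mk.inj h).2])) hadj
    | apex k => exact absurd (mem_apexes.2 ⟨k, rfl⟩) hv.2
  | apex k => exact absurd (mem_apexes.2 ⟨k, rfl⟩) hu.2

theorem isTightlyLinked_kept (ha : Satisfies C a) :
    IsTightlyLinked (graph C : SimpleGraph (ClubVertex ι κ q)) (kept a) q := by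
  have universal : ∀ x ∈ apexes ι κ q, ∀ v, v ≠ x → (graph C).Adj x v := by
    intro x hx v hv
    obtain ⟨k, rfl⟩ := mem_apexes.1 hx
    exact adj_apex k v hv
  have apexes_subset : (apexes ι κ q : Set (ClubVertex ι κ q)) ⊆ kept a := by
    intro x hx
    obtain ⟨k, rfl⟩ := mem_apexes.1 hx
    simp [kept]
  have nontrivial : (kept a \ apexes ι κ q : Set (ClubVertex ι κ q)).Nontrivial :=
    ⟨_, hub_mem_kept_sdiff_apexes true true, _, hub_mem_kept_sdiff_apexes false false, by simp⟩
  simpa only [card_apexes] using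
    (isLooselyLinked_kept_sdiff_apexes ha).isTightlyLinked_of_universal universal apexes_subset
      nontrivial

theorem isLooselyLinked_sdiff_apexes (hS : IsLooselyLinked (graph C) S q) :
    IsLooselyLinked (graph C) (S \ apexes ι κ q) 0 :=
  IsLooselyLinked.sdiff (apexes ι κ q) (by rwa [card_apexes])

theorem exists_lit_notMem (hS : IsLooselyLinked (graph C) (S \ apexes ι κ q) 0) (i : ι) :
    ∃ b, lit i b ∉ S := by
  by_contra! hmem
  have hmem' : ∀ b, lit i b ∈ S \ apexes ι κ q := fun b => ⟨hmem b, by simp [mem_apexes]⟩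
  obtain ⟨w, hw, htrue, hfalse⟩ := isLooselyLinked_zero.1 hS _ (hmem' true) _ (hmem' false)
    (by simp) (by simp [graph, Adj])
  cases w with
  | lit i' b => cases b <;> simp [graph, Adj] at htrue hfalse
  | clause j s => exact htrue.2 hfalse.1
  | hub x y => exact Bool.noConfusion ((show x = true from htrue).symm.trans hfalse)
  | apex k => exact hw.2 (mem_apexes.2 ⟨k, rfl⟩)

theorem eq_kept_of_isLooselyLinked [Finite ι] (hS : IsLooselyLinked (graph C) (S \ apexes ι κ q) 0)
    (hcard : Sᶜ.encard ≤ ENat.card ι) : ∃ a, S = kept a := by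
  choose f hf using exists_lit_notMem hS
  have hinj : Function.Injective fun i => (lit i (f i) : ClubVertex ι κ q) := fun i j h =>
    (lit.inj h).1
  have hrange : (Set.range fun i => lit i (f i)) = Sᶜ :=
    (Set.finite_range _).eq_of_subset_of_encard_le (Set.range_subset_iff.2 hf)
      (hcard.trans hinj.encard_range)
  exact ⟨fun i => !f i, by simp [kept, hrange]⟩

theorem satisfies_of_isLooselyLinked_kept
    (h : IsLooselyLinked (graph C : SimpleGraph (ClubVertex ι κ q)) (kept a \ apexes ι κ q) 0) :
    Satisfies C a := by
  intro j
  by_cases htaut : IsTautology (C j)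
  · obtain ⟨i, htrue, hfalse⟩ := htaut
    exact ⟨(i, a i), by cases a i <;> assumption, rfl⟩
  · obtain ⟨w, hw, htrue, hfalse⟩ := isLooselyLinked_zero.1 h
      (clause j true) (clause_mem_kept_sdiff_apexes j true)
      (clause j false) (clause_mem_kept_sdiff_apexes j false) (by simp)
      fun hadj => htaut (hadj.2 rfl)
    cases w with
    | lit i b => exact ⟨(i, b), htrue.1, lit_mem_kept.1 hw.1⟩
    | clause j' s => cases s <;> simp [graph, Adj] at htrue hfalse
    | hub x y => exact Bool.noConfusion ((show y = true from htrue).symm.trans hfalse)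
    | apex k => exact absurd (mem_apexes.2 ⟨k, rfl⟩) hw.2

theorem exists_satisfies_of_isLooselyLinked [Finite ι] (hS : IsLooselyLinked (graph C) S q)
    (hcard : Sᶜ.encard ≤ ENat.card ι) : ∃ a, Satisfies C a := by
  obtain ⟨a, rfl⟩ := eq_kept_of_isLooselyLinked (isLooselyLinked_sdiff_apexes hS) hcard
  exact ⟨a, satisfies_of_isLooselyLinked_kept (isLooselyLinked_sdiff_apexes hS)⟩

end ClubVertex

/-! ### The instance of a formula -/

/-- The literals of the clause with index `j`. -/
def CNFFormula.clauseSet (F : CNFFormula) (j : Fin F.clauses.length) :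
    Set (Fin F.numVars × Bool) :=
  {l | l ∈ F.clauses.get j}

theorem CNFFormula.satisfiable_iff {F : CNFFormula} :
    F.Satisfiable ↔ ∃ a, Satisfies F.clauseSet a :=
  exists_congr fun _ => List.forall_mem_iff_get

namespace ClubVertex

open FormulaTags

section Enumeration

variable {ι κ : Type*} {q : ℕ}

/-- The list of the hubs and the apexes. -/
def hubsAndApexes : List (ClubVertex ι κ q) :=
  [hub true true, hub true false, hub false true, hub false false] ++ (List.finRange q).map apex

variable (q) in
/-- The list of the vertices whose variable or clause, if any, belongs to the given lists. -/
def enum (is : List ι) (js : List κ) : List (ClubVertex ι κ q) :=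
  is.flatMap (fun i => [lit i true, lit i false]) ++
    js.flatMap (fun j => [clause j true, clause j false]) ++ hubsAndApexes

theorem mem_enum {is : List ι} {js : List κ} (his : ∀ i, i ∈ is) (hjs : ∀ j, j ∈ js)
    (v : ClubVertex ι κ q) : v ∈ enum q is js := by
  cases v with
  | lit i b => cases b <;> simp [enum, his]
  | clause j s => cases s <;> simp [enum, hjs]
  | hub x y => cases x <;> cases y <;> simp [enum, hubsAndApexes]
  | apex k => simp [enum, hubsAndApexes]

theorem nodup_hubsAndApexes : (hubsAndApexes : List (ClubVertex ι κ q)).Nodup :=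
  .append (by simp) ((List.nodup_finRange q).map fun _ _ h => apex.inj h)
    (by simp [List.Disjoint])

theorem nodup_enum {is : List ι} {js : List κ} (his : is.Nodup) (hjs : js.Nodup) :
    (enum q is js).Nodup := by
  refine .append (.append ?_ ?_ ?_) nodup_hubsAndApexes ?_
  · exact List.nodup_flatMap.2 ⟨by simp, his.imp fun h => by simp [Function.onFun, h.symm]⟩
  · exact List.nodup_flatMap.2 ⟨by simp, hjs.imp fun h => by simp [Function.onFun, h.symm]⟩
  · grind [List.Disjoint]
  · grind [List.Disjoint, hubsAndApexes]

theorem length_enum (is : List ι) (js : List κ) :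
    (enum q is js).length = 2 * is.length + 2 * js.length + 4 + q := by
  simp only [enum, hubsAndApexes, List.length_append, List.length_flatMap, List.length_map,
    List.length_finRange, List.length_cons, List.length_nil, List.map_const', List.sum_replicate,
    smul_eq_mul]
  omega

end Enumeration

section Descriptors

variable {q : ℕ} {F : CNFFormula}

/-- The tags for the vertices of the graph: vertices without an index. -/
def formulaTags (q : ℕ) : FormulaTags (ClubVertex Unit Unit q) :=
  ⟨lit (), clause (), hubsAndApexes⟩

/-- The descriptor of a vertex of the graph of a formula. -/
def descriptor : ClubVertex (Fin F.numVars) (Fin F.clauses.length) q →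
    Descriptor (ClubVertex Unit Unit q) (Bool × Bool)
  | lit i b => ⟨lit () b, unitVector F.numVars i⟩
  | clause j s => ⟨clause () s, clauseVector (F.clauses.get j)⟩
  | hub x y => ⟨hub x y, []⟩
  | apex k => ⟨apex k, []⟩

theorem length_symbols_descriptor_le
    (v : ClubVertex (Fin F.numVars) (Fin F.clauses.length) q) :
    (descriptor v).symbols.length ≤ F.numVars := by
  cases v <;> simp [descriptor]

/-- The part of the adjacency test that depends on the tags only. -/
def baseTest : ClubVertex Unit Unit q → ClubVertex Unit Unit q → Bool
  | lit _ b, hub x _ | hub x _, lit _ b => x == b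
  | clause _ s, hub _ y | hub _ y, clause _ s => y == s
  | hub x y, hub x' y' => (x, y) != (x', y')
  | apex k, apex k' => k != k'
  | apex _, _ | _, apex _ => true
  | _, _ => false

/-- The part of the adjacency test that depends on the occurrences `x` and `y` of the literals of
one variable. -/
def entryTest : ClubVertex Unit Unit q → ClubVertex Unit Unit q → Bool × Bool → Bool × Bool → Bool
  | lit _ b, lit _ b', x, y => b != b' && x != y
  | lit _ b, clause _ _, x, y | clause _ _, lit _ b, y, x => x == (true, true) && y == (b, !b)
  | clause _ s, clause _ s', x, y => s != s' && (x != y || x == (true, true))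
  | _, _, _, _ => false

/-- The test whether two descriptors belong to adjacent vertices. All vertices except the positive
literals are counted: their number is the required size of a club. -/
def adjTest (q : ℕ) : PairTest (ClubVertex Unit Unit q) (Bool × Bool) :=
  ⟨baseTest, entryTest, fun v => v != lit () true⟩

variable (q F) in
/-- The vertices of the graph of a formula, in the order of their descriptors. -/
def vertices : List (ClubVertex (Fin F.numVars) (Fin F.clauses.length) q) :=
  enum q (List.finRange F.numVars).reverse (List.finRange F.clauses.length)

theorem mem_vertices (v : ClubVertex (Fin F.numVars) (Fin F.clauses.length) q) :
    v ∈ vertices q F :=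
  mem_enum (by simp) (by simp) v

theorem nodup_vertices : (vertices q F).Nodup :=
  nodup_enum (List.nodup_reverse.2 (List.nodup_finRange _)) (List.nodup_finRange _)

theorem length_vertices :
    (vertices q F).length = 2 * F.numVars + 2 * F.clauses.length + 4 + q := by
  simp [vertices, length_enum]

theorem descriptors_eq_map_vertices :
    (formulaTags q).descriptors F = (vertices q F).map descriptor := by
  have clauses_eq : F.clauses = (List.finRange F.clauses.length).map F.clauses.get :=
    (List.map_get_finRange _).symm
  rw [descriptors, ← List.map_coe_finRange_eq_range, ← List.map_reverse]
  conv_lhs => enter [1, 2]; rw [clauses_eq]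
  simp only [List.flatMap_map, vertices, enum, hubsAndApexes, formulaTags, twoCopies, descriptor,
    List.map_append, List.map_flatMap, List.map_cons, List.map_nil, List.map_map,
    Function.comp_def]

theorem countP_counted_vertices :
    (vertices q F).countP (fun v => (adjTest q).counted (descriptor v).tag) =
      (vertices q F).length - F.numVars := by
  rw [length_vertices]
  have apex_ne (k : Fin q) : (apex k : ClubVertex Unit Unit q) ≠ lit () true := nofun
  simp only [adjTest, descriptor, vertices, enum, hubsAndApexes, List.cons_append, List.nil_append,
    List.append_assoc, List.countP_append, List.countP_flatMap, Function.comp_def,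
    bne_self_eq_false, Bool.false_eq_true, not_false_eq_true, List.countP_cons_of_neg, bne_iff_ne,
    ne_eq, lit.injEq, and_false, List.countP_cons_of_pos, List.countP_nil, zero_add,
    List.map_reverse, List.map_const', List.length_finRange, List.reverse_replicate,
    List.sum_replicate, smul_eq_mul, mul_one, reduceCtorEq, Nat.reduceAdd, List.countP_map,
    bne_iff_ne.2 (apex_ne _), List.countP_true]
  omega

theorem unitVector_eq {N : ℕ} (i : Fin N) :
    unitVector N i = (List.finRange N).reverse.map fun p => (decide (p = i), decide (p = i)) := by
  rw [unitVector, ← List.map_coe_finRange_eq_range, ← List.map_reverse, List.map_map]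
  simp only [Function.comp_def, Fin.ext_iff]

theorem clauseVector_eq {N : ℕ} (c : List (Fin N × Bool)) :
    clauseVector c =
      (List.finRange N).reverse.map fun p => (decide ((p, true) ∈ c), decide ((p, false) ∈ c)) :=
  List.map_congr_left fun p _ => by simp [record]

theorem eval_map_finRange {τ α : Type} (p : PairTest τ α) (x y : τ) {N : ℕ} (f g : Fin N → α) :
    p.eval ⟨x, (List.finRange N).reverse.map f⟩ ⟨y, (List.finRange N).reverse.map g⟩ = true ↔
      p.base x y = true ∨ ∃ i, p.sym x y (f i) (g i) = true := by
  simp [PairTest.eval, List.zip_map', -List.map_reverse]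

theorem eval_lit_lit (i i' : Fin F.numVars) (b b' : Bool) :
    (adjTest q).eval (descriptor (F := F) (lit i b)) (descriptor (lit i' b')) = true ↔
      (graph F.clauseSet).Adj (lit i b : ClubVertex _ _ q) (lit i' b') := by
  rw [descriptor, descriptor, unitVector_eq, unitVector_eq, eval_map_finRange]
  simp only [adjTest, baseTest, entryTest, graph, Adj, Bool.false_eq_true, Bool.and_eq_true,
    bne_iff_ne, ne_eq, Prod.mk.injEq, decide_eq_decide, and_self, exists_and_left, false_or,
    and_congr_right_iff]
  intro _
  constructor
  · rintro ⟨p, hp⟩ rfl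
    exact hp Iff.rfl
  · exact fun h => ⟨i, fun h' => h (h'.1 rfl)⟩

theorem eval_lit_clause (i : Fin F.numVars) (j : Fin F.clauses.length) (b s : Bool) :
    (adjTest q).eval (descriptor (lit i b)) (descriptor (clause j s)) = true ↔
      (graph F.clauseSet).Adj (lit i b : ClubVertex _ _ q) (clause j s) := by
  rw [descriptor, descriptor, unitVector_eq, clauseVector_eq, eval_map_finRange]
  simp only [adjTest, baseTest, entryTest, graph, Adj, CNFFormula.clauseSet]
  cases b <;> simp [and_comm]

theorem eval_clause_lit (i : Fin F.numVars) (j : Fin F.clauses.length) (b s : Bool) :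
    (adjTest q).eval (descriptor (clause j s)) (descriptor (lit i b)) = true ↔
      (graph F.clauseSet).Adj (clause j s : ClubVertex _ _ q) (lit i b) := by
  rw [descriptor, descriptor, unitVector_eq, clauseVector_eq, eval_map_finRange]
  simp only [adjTest, baseTest, entryTest, graph, Adj, CNFFormula.clauseSet]
  cases b <;> simp [and_comm]

theorem eval_clause_clause (j j' : Fin F.clauses.length) (s s' : Bool) :
    (adjTest q).eval (descriptor (clause j s)) (descriptor (clause j' s')) = true ↔
      (graph F.clauseSet).Adj (clause j s : ClubVertex _ _ q) (clause j' s') := by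
  rw [descriptor, descriptor, clauseVector_eq, clauseVector_eq, eval_map_finRange]
  simp only [adjTest, baseTest, entryTest, graph, Adj, CNFFormula.clauseSet, IsTautology,
    Bool.false_eq_true, Bool.and_eq_true, bne_iff_ne, ne_eq, Bool.or_eq_true, Prod.mk.injEq,
    decide_eq_decide, not_and, beq_iff_eq, decide_eq_true_eq, exists_and_left, false_or,
    Set.ext_iff, Set.mem_ofPred_eq, Prod.forall, Bool.forall_bool, and_congr_right_iff]
  grind

theorem eval_descriptor_iff (u v : ClubVertex (Fin F.numVars) (Fin F.clauses.length) q) :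
    (adjTest q).eval (descriptor u) (descriptor v) = true ↔ (graph F.clauseSet).Adj u v := by
  cases u with
  | lit i b =>
    cases v with
    | lit i' b' => exact eval_lit_lit i i' b b'
    | clause j s => exact eval_lit_clause i j b s
    | _ => simp [PairTest.eval, descriptor, adjTest, baseTest, graph, Adj]
  | clause j s =>
    cases v with
    | lit i b => exact eval_clause_lit i j b s
    | clause j' s' => exact eval_clause_clause j j' s s'
    | _ => simp [PairTest.eval, descriptor, adjTest, baseTest, graph, Adj]
  | _ => cases v <;> simp [PairTest.eval, descriptor, adjTest, baseTest, graph, Adj]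

end Descriptors

section Instance

variable {q t : ℕ} {F : CNFFormula}

variable (q F) in
/-- The vertices of the graph of a formula, numbered in the order of their descriptors. -/
def numbering :
    Fin (vertices q F).length ≃ ClubVertex (Fin F.numVars) (Fin F.clauses.length) q :=
  nodup_vertices.getEquivOfForallMemList _ mem_vertices

variable (q t F) in
/-- The instance to which a formula is reduced: a club may omit as many vertices as the formula
has variables. -/
def instanceOf : ClubInstance where
  n := (vertices q F).length
  graph := (graph F.clauseSet).comap (numbering q F)
  t := t
  k := (vertices q F).length - F.numVars

theorem instanceOf_connected : (instanceOf q t F).graph.Connected :=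
  (SimpleGraph.Iso.connected_iff (SimpleGraph.Iso.comap (numbering q F) _)).2 graph_connected

theorem numVars_le_length_vertices : F.numVars ≤ (vertices q F).length := by
  rw [length_vertices]
  omega

theorem report_eq_encode :
    (adjTest q).report t ((formulaTags q).descriptors F) = (instanceOf q t F).encode := by
  classical
  have vertices_eq : vertices q F = (List.finRange _).map (numbering q F) :=
    (List.map_get_finRange _).symm
  have matrix_eq : (((vertices q F).map descriptor).flatMap fun d =>
        ((vertices q F).map descriptor).map fun e => some ((adjTest q).eval d e)) =
      (List.finRange (instanceOf q t F).n).flatMap fun i => (List.finRange (instanceOf q t F).n).map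
        fun j => some ((adjTest q).eval (descriptor (numbering q F i))
          (descriptor (numbering q F j))) := by
    conv_lhs => rw [vertices_eq]
    simp only [List.map_map, List.flatMap_map]
    rfl
  rw [descriptors_eq_map_vertices, PairTest.report, List.countP_map, List.length_map, matrix_eq,
    ClubInstance.encode]
  refine congrArg₂ _ (congrArg₂ _ (congrArg _ (congrArg _ countP_counted_vertices)) rfl) ?_
  refine List.flatMap_congr fun i _ => List.map_congr_left fun j _ => congrArg some ?_
  rw [Bool.eq_iff_iff, decide_eq_true_iff]
  exact eval_descriptor_iff _ _

theorem exists_finset_sub_le_card_iff {α β : Type*} [Fintype α] (e : α ≃ β) (N : ℕ)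
    {p : Set α → Prop} :
    (∃ S : Finset α, Fintype.card α - N ≤ S.card ∧ p S) ↔
      ∃ S : Set β, Sᶜ.encard ≤ N ∧ p (e ⁻¹' S) := by
  classical
  have card_iff (S : Finset α) :
      Fintype.card α - N ≤ S.card ↔ (S : Set α)ᶜ.encard ≤ N := by
    rw [← Finset.coe_compl, Set.encard_coe_eq_coe_finsetCard, Nat.cast_le, Finset.card_compl,
      tsub_le_iff_tsub_le]
  have encard_preimage (S : Set β) : (e ⁻¹' S)ᶜ.encard = Sᶜ.encard := by
    rw [← Set.preimage_compl, Set.encard_preimage_of_bijective e.bijective]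
  constructor
  · rintro ⟨S, hcard, hS⟩
    have preimage_image : e ⁻¹' (e '' S) = S := e.preimage_image S
    refine ⟨e '' S, ?_, preimage_image.symm ▸ hS⟩
    rw [← encard_preimage, preimage_image]
    exact (card_iff S).1 hcard
  · rintro ⟨S, hcard, hS⟩
    obtain ⟨S', hS'⟩ := (e ⁻¹' S).toFinite.exists_finset_coe
    rw [← encard_preimage, ← hS', ← card_iff] at hcard
    exact ⟨S', hcard, hS'.symm ▸ hS⟩

theorem encard_compl_kept_le {ι κ : Type*} (a : ι → Bool) :
    (kept a : Set (ClubVertex ι κ q))ᶜ.encard ≤ ENat.card ι := by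
  rw [kept, compl_compl, ← Set.image_univ, ← Set.encard_univ]
  exact Set.encard_image_le _ _

theorem hasClub_iff {p : Set (Fin (instanceOf q t F).n) → Prop}
    (hloose : ∀ S, p S → IsLooselyLinked (instanceOf q t F).graph S q)
    (htight : ∀ S, IsTightlyLinked (instanceOf q t F).graph S q → p S) :
    (∃ S : Finset (Fin (instanceOf q t F).n), (instanceOf q t F).k ≤ S.card ∧ p S) ↔
      F.Satisfiable := by
  have card_vars : ENat.card (Fin F.numVars) = F.numVars := by simp
  have card_vertices :
      (instanceOf q t F).k = Fintype.card (Fin (instanceOf q t F).n) - F.numVars := by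
    rw [Fintype.card_fin]
    rfl
  rw [card_vertices, exists_finset_sub_le_card_iff (α := Fin (instanceOf q t F).n) (numbering q F),
    CNFFormula.satisfiable_iff]
  constructor
  · rintro ⟨S, hcard, hS⟩
    exact exists_satisfies_of_isLooselyLinked ((isLooselyLinked_comap _).1 (hloose _ hS))
      (card_vars ▸ hcard)
  · rintro ⟨a, ha⟩
    exact ⟨kept a, card_vars ▸ encard_compl_kept_le a,
      htight _ ((isTightlyLinked_comap _).2 (isTightlyLinked_kept ha))⟩

theorem hasRobustTwoClub_iff :
    (instanceOf q (q + 1) F).HasRobustTwoClub ↔ F.Satisfiable :=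
  hasClub_iff (fun _ h => h.isLooselyLinked) fun _ h => h.isRobustTwoClub

theorem hasHereditaryTwoClub_iff :
    (instanceOf q q F).HasHereditaryTwoClub ↔ F.Satisfiable :=
  hasClub_iff (fun _ h => h.isLooselyLinked) fun _ h => h.isHereditaryTwoClub

end Instance

end ClubVertex

/-! ### Running times -/

theorem ReachesWithin.pos {α : Type*} {f : α → Option α} {T : ℕ} {a b : α}
    (h : ReachesWithin f T a b) (hab : a ≠ b) : 0 < T := by
  obtain ⟨⟨⟨n, hn⟩, hnT⟩⟩ := h
  refine lt_of_lt_of_le (Nat.pos_of_ne_zero ?_) hnT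
  rintro rfl
  exact hab (Option.some.inj hn)

theorem OutputsWithin.pos {Γ₀ Γ₁ : Type} {M : TM2ComputableAux Γ₀ Γ₁} {T : ℕ} {s : List Γ₀}
    {s' : List Γ₁} (h : OutputsWithin M T s s') : 0 < T :=
  (outputsWithin_iff_reachesWithin.1 h).pos fun hcfg => nomatch congrArg TM2.Cfg.l hcfg

theorem SolvableInTime.bound_pos {ι : Type} {enc : ι → List (Option Bool)}
    {valid yes : ι → Prop} {bound : ι → ℝ} (h : SolvableInTime enc valid yes bound) {x : ι}
    (hx : valid x) : 0 < bound x := by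
  obtain ⟨M, hM⟩ := h
  obtain ⟨T, hT, run⟩ := hM x hx
  exact (Nat.cast_pos.2 (OutputsWithin.pos run)).trans_le hT

theorem CNFFormula.length_clauses_add_numVars_lt (F : CNFFormula) :
    F.clauses.length + F.numVars < F.encode.length := by
  have clauses_le (cs : List (List (Fin F.numVars × Bool))) :
      cs.length ≤ (cs.flatMap fun c =>
        (c.flatMap fun l => some l.2 :: encodeUnary l.1) ++ [none]).length := by
    induction cs with
    | nil => exact le_rfl
    | cons c cs ih =>
      rw [List.flatMap_cons, List.length_append, List.length_append, List.length_cons,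
        List.length_singleton]
      omega
  have := clauses_le F.clauses
  rw [CNFFormula.encode, encodeUnary, List.length_append, List.length_append, List.length_replicate,
    List.length_singleton]
  omega

theorem Descriptor.length_tokens_le {τ α : Type} {D : List (Descriptor τ α)} {B : ℕ}
    (hB : ∀ d ∈ D, d.symbols.length ≤ B) : (tokens D).length ≤ D.length * (B + 1) := by
  rw [tokens, List.length_flatMap]
  refine (List.sum_le_card_nsmul _ (B + 1) ?_).trans_eq (by simp)
  simpa using hB

theorem ClubInstance.length_encode (x : ClubInstance) :
    x.encode.length = x.t + x.k + x.n + 3 + x.n * x.n := by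
  simp only [ClubInstance.encode, encodeUnary, List.length_append, List.length_replicate,
    List.length_cons, List.length_nil, List.length_flatMap, List.length_map, List.length_finRange,
    List.map_const', List.sum_replicate, smul_eq_mul]
  omega

theorem polynomial_add_exponential_le {K A L n P C : ℝ} (c : ℕ) (hK : 0 ≤ K) (hA : 0 ≤ A)
    (hL : 1 ≤ L) (hn : 0 ≤ n) (hnL : n ≤ A * L) (hP : 1 ≤ P) (hC : 0 ≤ C) :
    K * (A * L) ^ 3 + C * P * n ^ c ≤ (K * A ^ 3 + C * A ^ c) * P * L ^ (3 + c) := by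
  have hL₃ : L ^ 3 ≤ P * L ^ (3 + c) :=
    calc L ^ 3 ≤ L ^ (3 + c) := pow_le_pow_right₀ hL (by omega)
      _ ≤ P * L ^ (3 + c) := le_mul_of_one_le_left (by positivity) hP
  have hLc : L ^ c ≤ L ^ (3 + c) := pow_le_pow_right₀ hL (by omega)
  calc K * (A * L) ^ 3 + C * P * n ^ c
      ≤ K * (A * L) ^ 3 + C * P * (A * L) ^ c := by gcongr
    _ = K * A ^ 3 * L ^ 3 + C * P * A ^ c * L ^ c := by ring
    _ ≤ K * A ^ 3 * (P * L ^ (3 + c)) + C * P * A ^ c * L ^ (3 + c) := by gcongr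
    _ = (K * A ^ 3 + C * A ^ c) * P * L ^ (3 + c) := by ring

namespace ClubVertex

open FormulaTags

section Reduction

variable {q t : ℕ} {F : CNFFormula}

variable (q t F) in
/-- A bound for the number of vertices of the instance of a formula and for the other parameters in
the running time of its construction. -/
def sizeBound : ℕ :=
  (4 + q + t) * F.encode.length

theorem numVars_add_two_le_sizeBound : F.numVars + 2 ≤ sizeBound q t F := by
  have := F.length_clauses_add_numVars_lt
  rw [sizeBound]
  nlinarith

theorem length_clauses_le_sizeBound : F.clauses.length ≤ sizeBound q t F := by
  have := F.length_clauses_add_numVars_lt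
  rw [sizeBound]
  nlinarith

theorem length_encode_le_sizeBound : F.encode.length ≤ sizeBound q t F :=
  Nat.le_mul_of_pos_left _ (by omega)

theorem le_sizeBound : t ≤ sizeBound q t F := by
  have := F.length_clauses_add_numVars_lt
  rw [sizeBound]
  nlinarith

theorem length_vertices_le_sizeBound : (vertices q F).length ≤ sizeBound q t F := by
  have := F.length_clauses_add_numVars_lt
  rw [length_vertices, sizeBound]
  nlinarith

theorem length_encode_instanceOf_le :
    (instanceOf q t F).encode.length + 1 ≤ 8 * sizeBound q t F ^ 3 := by
  have pos : 2 ≤ sizeBound q t F := le_of_add_le_right numVars_add_two_le_sizeBound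
  have ht : (instanceOf q t F).t ≤ sizeBound q t F := le_sizeBound
  have hn : (instanceOf q t F).n ≤ sizeBound q t F := length_vertices_le_sizeBound
  have hk : (instanceOf q t F).k ≤ sizeBound q t F := (Nat.sub_le _ _).trans hn
  rw [ClubInstance.length_encode]
  generalize sizeBound q t F = X at *
  calc _ ≤ X + X + X + 3 + X * X + 1 := by gcongr
    _ ≤ 8 * X ^ 3 := by nlinarith [sq_nonneg X]

variable (q t) in
/-- The machine that writes the instance of a formula. -/
noncomputable def reduction : TM2ComputableAux (Option Bool) (Option Bool) :=
  runThen (formulaTags q).machine ((adjTest q).machine t)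

theorem length_symbols_le_of_mem_descriptors
    {d : Descriptor (ClubVertex Unit Unit q) (Bool × Bool)}
    (hd : d ∈ (formulaTags q).descriptors F) : d.symbols.length ≤ F.numVars := by
  rw [descriptors_eq_map_vertices] at hd
  obtain ⟨v, -, rfl⟩ := List.mem_map.1 hd
  exact length_symbols_descriptor_le v

theorem outputsWithin_reduction :
    OutputsWithin (reduction q t) (42 * sizeBound q t F ^ 3) F.encode
      (instanceOf q t F).encode.reverse := by
  have report := (adjTest q).outputsWithin_report t ((formulaTags q).descriptors F)
    fun _ => length_symbols_le_of_mem_descriptors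
  rw [report_eq_encode] at report
  refine ReachesWithin.mono
    (((formulaTags q).outputsWithin_tokens_descriptors F).comp report) ?_
  have hN : F.numVars + 2 ≤ sizeBound q t F := numVars_add_two_le_sizeBound
  have hm : F.clauses.length ≤ sizeBound q t F := length_clauses_le_sizeBound
  have hL : F.encode.length ≤ sizeBound q t F := length_encode_le_sizeBound
  have hn : ((formulaTags q).descriptors F).length ≤ sizeBound q t F := by
    rw [descriptors_eq_map_vertices, List.length_map]
    exact length_vertices_le_sizeBound
  have hW : (Descriptor.tokens ((formulaTags q).descriptors F)).length ≤
      sizeBound q t F * sizeBound q t F :=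
    (Descriptor.length_tokens_le fun _ => length_symbols_le_of_mem_descriptors).trans
      (Nat.mul_le_mul hn (by omega))
  generalize ((formulaTags q).descriptors F) = D at *
  generalize sizeBound q t F = X at *
  have hN' : F.numVars ≤ X := by omega
  calc _ ≤ 3 * X * X + 5 * X + 2 * X + X * (3 * X + 4) + 3 + (X * X + 1) +
        (X * (3 * X + 2 * (X * X) + X * X + 6) + 3 * (X * X) + 5) := by gcongr
    _ ≤ 42 * X ^ 3 := by nlinarith [sq_nonneg X]

variable {yes : ClubInstance → Prop} {ε : ℝ}

theorem solvableInTime_satisfiable (hyes : ∀ F, yes (instanceOf q t F) ↔ F.Satisfiable)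
    (h : AdmitsDualParameterAlgorithm yes t ε) :
    ∃ C c : ℕ, SolvableInTime CNFFormula.encode (fun _ => True) CNFFormula.Satisfiable fun F =>
      50 * (sizeBound q t F : ℝ) ^ 3 + C * (2 - ε) ^ F.numVars * (vertices q F).length ^ c := by
  obtain ⟨C, c, h⟩ := h
  refine ⟨C, c, (SolvableInTime.of_reduction (fun F _ => outputsWithin_reduction)
    (fun F _ => ⟨rfl, instanceOf_connected, Nat.sub_le _ _⟩) (fun F _ => hyes F) h).mono ?_⟩
  intro F _
  have parameter_eq : (instanceOf q t F).n - (instanceOf q t F).k = F.numVars :=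
    Nat.sub_sub_self numVars_le_length_vertices
  have length_encode_le : ((instanceOf q t F).encode.length : ℝ) + 1 ≤ 8 * sizeBound q t F ^ 3 :=
    mod_cast length_encode_instanceOf_le
  have n_eq : (instanceOf q t F).n = (vertices q F).length := rfl
  rw [parameter_eq, n_eq]
  push_cast
  linarith

end Reduction

end ClubVertex

theorem AdmitsDualParameterAlgorithm.lt_two {yes : ClubInstance → Prop} {t : ℕ} {ε : ℝ}
    (h : AdmitsDualParameterAlgorithm yes t ε) : ε < 2 := by
  obtain ⟨C, c, h⟩ := h
  have bound_pos := h.bound_pos (x := ⟨1, ⊥, t, 0⟩) ⟨rfl, .of_subsingleton, Nat.zero_le 1⟩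
  have bound_eq : (C : ℝ) * (2 - ε) ^ (1 - 0) * ((1 : ℕ) : ℝ) ^ c = C * (2 - ε) := by simp
  rw [bound_eq] at bound_pos
  linarith [pos_of_mul_pos_right bound_pos C.cast_nonneg]

theorem AdmitsDualParameterAlgorithm.mono {yes : ClubInstance → Prop} {t : ℕ} {ε ε' : ℝ}
    (h : AdmitsDualParameterAlgorithm yes t ε) (hε : ε' ≤ ε) :
    AdmitsDualParameterAlgorithm yes t ε' := by
  have base_nonneg : 0 ≤ 2 - ε := sub_nonneg.2 h.lt_two.le
  obtain ⟨C, c, h⟩ := h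
  exact ⟨C, c, h.mono fun x _ => by gcongr⟩

theorem not_admitsDualParameterAlgorithm (hSETH : StrongExponentialTimeHypothesis)
    {yes : ClubInstance → Prop} {q t : ℕ}
    (hyes : ∀ F, yes (ClubVertex.instanceOf q t F) ↔ F.Satisfiable) {ε : ℝ} (hε : 0 < ε) :
    ¬ AdmitsDualParameterAlgorithm yes t ε := by
  intro h
  obtain ⟨C, c, solvable⟩ :=
    ClubVertex.solvableInTime_satisfiable hyes (h.mono (min_le_left ε 1))
  refine hSETH (min ε 1) (lt_min hε one_pos)
    ⟨50 * (4 + q + t) ^ 3 + C * (4 + q + t) ^ c, 3 + c, solvable.mono fun F _ => ?_⟩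
  have length_pos : (1 : ℝ) ≤ F.encode.length :=
    Nat.one_le_cast.2 (Nat.one_le_of_lt F.length_clauses_add_numVars_lt)
  have length_vertices_le :
      ((ClubVertex.vertices q F).length : ℝ) ≤ ((4 + q + t : ℕ) : ℝ) * F.encode.length :=
    mod_cast ClubVertex.length_vertices_le_sizeBound
  have one_le_base : 1 ≤ 2 - min ε 1 := by linarith [min_le_right ε 1]
  have bound_le := polynomial_add_exponential_le c (K := 50) (by simp) (Nat.cast_nonneg (4 + q + t))
    length_pos (Nat.cast_nonneg _) length_vertices_le (one_le_pow₀ one_le_base (n := F.numVars))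
    (Nat.cast_nonneg C)
  exact_mod_cast bound_le

theorem mainTheorem4 (hSETH : StrongExponentialTimeHypothesis) :
    (∀ t : ℕ, 1 ≤ t → ∀ ε : ℝ, 0 < ε →
      ¬ AdmitsDualParameterAlgorithm ClubInstance.HasRobustTwoClub t ε) ∧
    (∀ t : ℕ, ∀ ε : ℝ, 0 < ε →
      ¬ AdmitsDualParameterAlgorithm ClubInstance.HasHereditaryTwoClub t ε) := by
  refine ⟨fun t ht ε hε => ?_, fun t ε hε => ?_⟩
  · obtain ⟨q, rfl⟩ := Nat.exists_eq_add_of_le' ht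
    exact not_admitsDualParameterAlgorithm hSETH (fun _ => ClubVertex.hasRobustTwoClub_iff) hε
  · exact not_admitsDualParameterAlgorithm hSETH (fun _ => ClubVertex.hasHereditaryTwoClub_iff) hε
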